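/- For a permutation $\pi=\pi_1\pi_2\cdots\pi_n$ of $[n]=\{1,\dots,n\}$ let $D(\pi)=\sum_{i=1}^n|\pi_i-i|$, let $I(\pi)=\#\{(i,j): i<j,\ \pi_i>\pi_j\}$ be its number of inversions, and let $T(\pi)=n-\mathrm{cyc}(\pi)$ be its reflection length, where $\mathrm{cyc}(\pi)$ is the number of cycles of $\pi$ (fixed points included). Call $\pi$ shallow if $I(\pi)+T(\pi)=D(\pi)$; say that $\pi$ avoids $123$ if there are no indices $i<j<k$ with $\pi_i<\pi_j<\pi_k$; and call $\pi$ persymmetric if $\pi=(\pi^{rc})^{-1}$, where the reverse-complement $\pi^{rc}$ is defined by $\pi^{rc}_{n+1-i}=n+1-\pi_i$ for all $i\in[n]$. **Theorem.** For $n\ge 0$ let $p_n$ be the number of permutations of $[n]$ that are shallow, $123$-avoiding and persymmetric (so $p_0=1$, counting the empty permutation). Then, as formal power series in $\mathbb{Q}[[x]]$, $$\sum_{n\ge 0}p_n x^n=\frac{x^6+x^5+x^3-2x^2+1}{(x-1)^2(x+1)(1-2x^2-x^4)}.$$ -/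

import Mathlib

namespace ShallowPerm

variable {n : ℕ}

/-- Total displacement `D(π) = ∑ |π_i - i|`. -/
def totalDisplacement (π : Equiv.Perm (Fin n)) : ℤ :=
  ∑ i : Fin n, |((π i : ℕ) : ℤ) - ((i : ℕ) : ℤ)|

/-- Inversion number `I(π) = ∑_i #{j | i < j, π_i > π_j}`. -/
def inversionNumber (π : Equiv.Perm (Fin n)) : ℕ :=
  ∑ i : Fin n, (Finset.univ.filter fun j : Fin n => i < j ∧ π j < π i).card

/-- Number of cycles in the disjoint cycle decomposition, fixed points included:
`Equiv.Perm.partition` is the full cycle type, with one part equal to `1` per fixed point. -/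
def numCycles (π : Equiv.Perm (Fin n)) : ℕ :=
  Multiset.card π.partition.parts

/-- Reflection length `T(π) = n - cyc(π)`. -/
def reflectionLength (π : Equiv.Perm (Fin n)) : ℤ :=
  (n : ℤ) - (numCycles π : ℤ)

/-- `π` is shallow if `I(π) + T(π) = D(π)`. -/
def IsShallow (π : Equiv.Perm (Fin n)) : Prop :=
  (inversionNumber π : ℤ) + reflectionLength π = totalDisplacement π

/-- `π` avoids the pattern `123`. -/
def Avoids123 (π : Equiv.Perm (Fin n)) : Prop :=
  ¬ ∃ i j k : Fin n, i < j ∧ j < k ∧ π i < π j ∧ π j < π k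

/-- The reverse-complement: it maps `n + 1 - i` to `n + 1 - π_i` (in one-based notation). -/
def reverseComplement (π : Equiv.Perm (Fin n)) : Equiv.Perm (Fin n) :=
  Fin.revPerm * π * Fin.revPerm

/-- `π` is persymmetric if it equals its reverse-complement-inverse. -/
def IsPersymmetric (π : Equiv.Perm (Fin n)) : Prop :=
  π = (reverseComplement π)⁻¹

/-- The number of shallow `123`-avoiding persymmetric permutations of length `n`. -/
noncomputable def persymmetricCount (n : ℕ) : ℕ :=
  Set.ncard {π : Equiv.Perm (Fin n) | IsShallow π ∧ Avoids123 π ∧ IsPersymmetric π}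

end ShallowPerm

namespace ShallowPerm

open Equiv Equiv.Perm

variable {n : ℕ}

/-! ### Reflection length -/

/-! Call D - I - T the defect. Removing a point i from its cycle (`contract`) lowers T by one. If i
is a peak, meaning that both π i and the preimage j of i lie below i, the defect drops by twice the
difference between i - 1 - max(j, π i) and the number of points of the graph of π in the open box
(j, i) × (π i, i). This difference is never negative, so the defect is nonnegative by induction, and
π is shallow iff its contraction is shallow and the box is full in its shorter direction
(`isShallow_peak_iff`; valleys follow by reverse-complement). Shallowness is decided throughout by
peeling points in this way.

Call a permutation good if it is counted by p_n, and let s_n be the number of good ones starting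
with the maximum. Positions and values are zero-based. Inversion exchanges "starts with the maximum"
and "ends with the minimum". The good permutations with both properties are the `wrap` of good ones
of length n - 2. For n ≥ 3, those with neither are a single sum of two equal decreasing blocks when
n is even, and none when n is odd. Hence p_n + p_(n-2) = 2 s_n + [n even].

Those starting with the maximum are split by the position of the minimum. Last position: p_(n-2).
Penultimate: s_(n-2), by `wrapTwo` and inversion. Earlier: an explicit family `excFn` indexed by the
last entry m with 2 ≤ m ≤ ⌊(n-1)/2⌋; `IsGood.eq_excFn` shows that nothing else occurs and
`exists_excPerm` that every member does.

Eliminating s_n gives p_(n+4) = 2 p_(n+2) + p_n + 2⌊(n+1)/2⌋. The factor 1 - 2x² - x⁴ of the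
denominator encodes the homogeneous part, and (x-1)²(x+1) annihilates the floor term. -/

theorem reflectionLength_eq (π : Perm (Fin n)) :
    reflectionLength π = (π.support.card : ℤ) - (Multiset.card π.cycleType : ℤ) := by
  have h : π.support.card ≤ n := by simpa using Finset.card_le_univ π.support
  simp only [reflectionLength, numCycles, parts_partition, Multiset.card_add,
    Multiset.card_replicate, Fintype.card_fin]
  push_cast [Nat.cast_sub h]
  ring

theorem reflectionLength_one : reflectionLength (1 : Perm (Fin n)) = 0 := by
  simp [reflectionLength_eq]

theorem reflectionLength_inv (π : Perm (Fin n)) :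
    reflectionLength π⁻¹ = reflectionLength π := by
  simp [reflectionLength_eq, cycleType_inv]

theorem reflectionLength_conj (π τ : Perm (Fin n)) :
    reflectionLength (τ * π * τ⁻¹) = reflectionLength π := by
  simp [reflectionLength_eq, cycleType_conj]

theorem reflectionLength_mul_of_disjoint {f g : Perm (Fin n)} (h : f.Disjoint g) :
    reflectionLength (f * g) = reflectionLength f + reflectionLength g := by
  simp only [reflectionLength_eq, h.cycleType_mul, h.card_support_mul, Multiset.card_add]
  push_cast
  ring

theorem reflectionLength_of_isCycle {f : Perm (Fin n)} (h : f.IsCycle) :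
    reflectionLength f = (f.support.card : ℤ) - 1 := by
  simp [reflectionLength_eq, h.cycleType]

/-- The permutation obtained by removing `i` from its cycle, making it a fixed point. -/
def contract (π : Perm (Fin n)) (i : Fin n) : Perm (Fin n) := swap i (π i) * π

theorem contract_apply (π : Perm (Fin n)) (i c : Fin n) :
    contract π i c = if c = i then i else if π c = i then π i else π c := by
  rw [contract, Perm.mul_apply]
  split_ifs with h1 h2
  · rw [h1, swap_apply_right]
  · rw [h2, swap_apply_left]
  · exact swap_apply_of_ne_of_ne h2 fun h => h1 (π.injective h)

theorem reflectionLength_contract_of_isCycle {f : Perm (Fin n)} (hf : f.IsCycle) {x : Fin n}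
    (hx : f x ≠ x) : reflectionLength (contract f x) + 1 = reflectionLength f := by
  by_cases hxx : f (f x) = x
  · have : f = swap x (f x) := hf.eq_swap_of_apply_apply_eq_self hx hxx
    have h1 : contract f x = 1 := by
      rw [contract]; nth_rewrite 2 [this]; exact swap_mul_self _ _
    rw [h1, reflectionLength_one, reflectionLength_of_isCycle hf, this,
      card_support_swap (Ne.symm hx)]
    norm_num
  · rw [contract, reflectionLength_of_isCycle (hf.swap_mul hx hxx), reflectionLength_of_isCycle hf,
      support_swap_mul_eq _ _ hxx, Finset.sdiff_singleton_eq_erase,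
      Finset.card_erase_of_mem (mem_support.2 hx)]
    have : 0 < f.support.card := Finset.card_pos.2 ⟨x, mem_support.2 hx⟩
    push_cast [Nat.cast_sub this]
    ring

/-- Only the cycle through x changes. The other cycles form a disjoint factor, over which reflection
length is additive, so the case of a single cycle suffices. -/
theorem reflectionLength_contract {π : Perm (Fin n)} {x : Fin n} (hx : π x ≠ x) :
    reflectionLength (contract π x) + 1 = reflectionLength π := by
  set c := π.cycleOf x with hc
  have hcyc : c.IsCycle := isCycle_cycleOf π hx
  have hcx : c x = π x := cycleOf_apply_self π x
  have hd : (π * c⁻¹).Disjoint c := disjoint_mul_inv_of_mem_cycleFactorsFinset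
    (cycleOf_mem_cycleFactorsFinset_iff.2 (mem_support.2 hx))
  have hπ : π = c * (π * c⁻¹) := by rw [← hd.commute.eq]; simp
  have h1 : contract π x = contract c x * (π * c⁻¹) := by
    rw [contract, contract, hcx, mul_assoc, ← hπ]
  have hd' : (contract c x).Disjoint (π * c⁻¹) := by
    intro y
    rcases hd y with h | h
    · exact Or.inr h
    · left
      rw [contract_apply]
      split_ifs with h2 h3
      · exact h2.symm
      · rw [h] at h3; exact absurd h3 h2
      · exact h
  have h2 := reflectionLength_contract_of_isCycle hcyc (x := x) (by rw [hcx]; exact hx)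
  rw [h1, reflectionLength_mul_of_disjoint hd']
  conv_rhs => rw [hπ, reflectionLength_mul_of_disjoint hd.symm]
  linarith

/-! ### Total displacement and inversions -/

theorem totalDisplacement_inv (π : Perm (Fin n)) :
    totalDisplacement π⁻¹ = totalDisplacement π := by
  unfold totalDisplacement
  rw [← Equiv.sum_comp π]
  refine Finset.sum_congr rfl fun i _ => ?_
  have h : π⁻¹ (π i) = i := by simp
  rw [h, abs_sub_comm]

theorem reverseComplement_apply (π : Perm (Fin n)) (i : Fin n) :
    reverseComplement π i = (π i.rev).rev := by
  simp [reverseComplement]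

theorem totalDisplacement_reverseComplement (π : Perm (Fin n)) :
    totalDisplacement (reverseComplement π) = totalDisplacement π := by
  unfold totalDisplacement
  rw [← Equiv.sum_comp Fin.revPerm]
  refine Finset.sum_congr rfl fun i _ => ?_
  have h1 := i.isLt
  have h2 := (π i).isLt
  rw [reverseComplement_apply]
  simp only [Fin.revPerm_apply, Fin.rev_rev, Fin.val_rev]
  rw [abs_sub_comm]
  congr 1
  omega

/-- The indicator of the (unordered) pair `a, b` being an inversion. -/
def invPair (π : Perm (Fin n)) (a b : Fin n) : ℤ :=
  if (a < b ∧ π b < π a) ∨ (b < a ∧ π a < π b) then 1 else 0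

theorem invPair_comm (π : Perm (Fin n)) (a b : Fin n) : invPair π a b = invPair π b a := by
  unfold invPair
  exact if_congr or_comm rfl rfl

/-- Because `invPair` ignores the order of its two points, the double sum can be reindexed along any
bijection. This gives the invariance of I under inversion and reverse-complement. -/
theorem sum_invPair (π : Perm (Fin n)) :
    ∑ a, ∑ b, invPair π a b = 2 * (inversionNumber π : ℤ) := by
  have h1 : ∀ a b, invPair π a b =
      (if a < b ∧ π b < π a then (1 : ℤ) else 0) + (if b < a ∧ π a < π b then (1 : ℤ) else 0) := by
    intro a b
    unfold invPair
    by_cases h : a < b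
    · simp [h, not_lt_of_gt h]
    · simp [h]
  have h2 : (inversionNumber π : ℤ) = ∑ a, ∑ b, if a < b ∧ π b < π a then (1 : ℤ) else 0 := by
    unfold inversionNumber
    push_cast [Finset.card_filter]
    rfl
  simp_rw [h1, Finset.sum_add_distrib]
  rw [h2, two_mul]
  congr 1
  rw [Finset.sum_comm]

theorem inversionNumber_inv (π : Perm (Fin n)) : inversionNumber π⁻¹ = inversionNumber π := by
  have h : ∑ a, ∑ b, invPair π⁻¹ a b = ∑ a, ∑ b, invPair π a b := by
    rw [← Equiv.sum_comp π]
    refine Finset.sum_congr rfl fun a _ => ?_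
    rw [← Equiv.sum_comp π]
    refine Finset.sum_congr rfl fun b _ => ?_
    unfold invPair
    have h : ∀ c, π⁻¹ (π c) = c := fun c => by simp
    simp only [h]
    refine if_congr ?_ rfl rfl
    tauto
  rw [sum_invPair, sum_invPair] at h
  omega

theorem inversionNumber_reverseComplement (π : Perm (Fin n)) :
    inversionNumber (reverseComplement π) = inversionNumber π := by
  have h : ∑ a, ∑ b, invPair (reverseComplement π) a b = ∑ a, ∑ b, invPair π a b := by
    rw [← Equiv.sum_comp Fin.revPerm]
    refine Finset.sum_congr rfl fun a _ => ?_
    rw [← Equiv.sum_comp Fin.revPerm]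
    refine Finset.sum_congr rfl fun b _ => ?_
    unfold invPair
    simp only [reverseComplement_apply, Fin.revPerm_apply, Fin.rev_rev, Fin.rev_lt_rev]
    refine if_congr ?_ rfl rfl
    tauto
  rw [sum_invPair, sum_invPair] at h
  omega

/-- The defect `D(π) - I(π) - T(π)`. -/
def defect (π : Perm (Fin n)) : ℤ :=
  totalDisplacement π - inversionNumber π - reflectionLength π

theorem isShallow_iff_defect (π : Perm (Fin n)) : IsShallow π ↔ defect π = 0 := by
  unfold IsShallow defect
  constructor <;> intro h <;> linarith

theorem defect_inv (π : Perm (Fin n)) : defect π⁻¹ = defect π := by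
  simp [defect, totalDisplacement_inv, inversionNumber_inv, reflectionLength_inv]

theorem defect_reverseComplement (π : Perm (Fin n)) :
    defect (reverseComplement π) = defect π := by
  have h : reflectionLength (reverseComplement π) = reflectionLength π := by
    rw [← reflectionLength_conj π Fin.revPerm]
    rfl
  rw [defect, defect, totalDisplacement_reverseComplement, inversionNumber_reverseComplement, h]

theorem isShallow_inv (π : Perm (Fin n)) : IsShallow π⁻¹ ↔ IsShallow π := by
  rw [isShallow_iff_defect, isShallow_iff_defect, defect_inv]

theorem isShallow_reverseComplement (π : Perm (Fin n)) :
    IsShallow (reverseComplement π) ↔ IsShallow π := by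
  rw [isShallow_iff_defect, isShallow_iff_defect, defect_reverseComplement]

/-! ### Contracting a peak -/

theorem totalDisplacement_contract {π : Perm (Fin n)} {i j : Fin n} (hj : π j = i) (hji : j ≠ i) :
    totalDisplacement π - totalDisplacement (contract π i) =
      |(i : ℤ) - j| + |((π i : ℕ) : ℤ) - i| - |((π i : ℕ) : ℤ) - j| := by
  unfold totalDisplacement
  rw [← Finset.sum_sub_distrib, Fintype.sum_eq_add j i hji]
  · simp only [contract_apply, hj, if_true, if_neg hji]
    simp
    ring
  · rintro c ⟨h1, h2⟩
    have : π c ≠ i := fun h => h1 (π.injective (h.trans hj.symm))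
    simp [contract_apply, h2, this]

/-- Only pairs meeting {i, j} can change status. The pair (i, j) itself loses one inversion; a
further point loses two if it lies in the box and has net change zero otherwise. -/
theorem inversionNumber_contract_peak {π : Perm (Fin n)} {i j : Fin n} (hj : π j = i) (hji : j < i)
    (hk : π i < i) :
    (inversionNumber π : ℤ) - inversionNumber (contract π i) = 1 + 2 *
      ((Finset.univ.filter fun c => j < c ∧ c < i ∧ π i < π c ∧ π c < i).card : ℤ) := by
  set π' := contract π i with hπ'
  set k := π i with hki
  have e1 : π' j = k := by rw [hπ', contract_apply, if_neg hji.ne, if_pos hj]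
  have e2 : π' i = i := by rw [hπ', contract_apply, if_pos rfl]
  have e3 : ∀ c, c ≠ i → c ≠ j → π' c = π c := fun c h1 h2 => by
    rw [hπ', contract_apply, if_neg h1,
      if_neg fun h => h2 (π.injective (h.trans hj.symm))]
  set Δ : Fin n → Fin n → ℤ := fun a b => invPair π a b - invPair π' a b with hΔ
  have hsymm : ∀ a b, Δ a b = Δ b a := fun a b => by
    simp only [hΔ, invPair_comm π a b, invPair_comm π' a b]
  have hz : ∀ a b, a ≠ i → a ≠ j → b ≠ i → b ≠ j → Δ a b = 0 := fun a b h1 h2 h3 h4 => by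
    simp only [hΔ, invPair, e3 a h1 h2, e3 b h3 h4, sub_self]
  have hrow : ∀ a, a ≠ i → a ≠ j → ∑ b, Δ a b = Δ a j + Δ a i := fun a h1 h2 =>
    Fintype.sum_eq_add j i hji.ne fun b hb => hz a b h1 h2 hb.2 hb.1
  have hself : ∀ a, Δ a a = 0 := fun a => by simp [hΔ, invPair]
  have hij : Δ i j = 1 := by
    simp only [hΔ, invPair, e1, e2, hj, ← hki]
    simp [hji, hk, hji.le, hk.le]
  have hbox : ∀ a, a ≠ i → a ≠ j →
      Δ a j + Δ a i = 2 * if j < a ∧ a < i ∧ k < π a ∧ π a < i then 1 else 0 := by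
    intro a h1 h2
    have h3 : π a ≠ i := fun h => h2 (π.injective (h.trans hj.symm))
    have h4 : π a ≠ k := fun h => h1 (π.injective h)
    simp only [hΔ, invPair, e1, e2, e3 a h1 h2, hj, ← hki]
    simp only [Fin.lt_def, Fin.ext_iff, ne_eq] at *
    split_ifs <;> omega
  set B := (Finset.univ.filter fun c => j < c ∧ c < i ∧ k < π c ∧ π c < i).card with hB
  have hG : ∑ a, (Δ a j + Δ a i) = 2 * B + 2 := by
    have h1 : ∑ a, ((Δ a j + Δ a i) - 2 * if j < a ∧ a < i ∧ k < π a ∧ π a < i then 1 else 0) =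
        2 := by
      rw [Fintype.sum_eq_add j i hji.ne]
      · simp [hself, hsymm j i, hij]
      · rintro c ⟨h1, h2⟩
        rw [hbox c h2 h1, sub_self]
    rw [Finset.sum_sub_distrib, ← Finset.mul_sum, Finset.sum_boole] at h1
    linarith
  -- `Δ` lives on rows and columns i, j. The two rows sum to 2B + 2, as do the two columns; the
  -- overlap, the entries (i, j) and (j, i), was counted twice.
  have htot : ∑ a, ∑ b, Δ a b = 2 * (2 * B + 2) - 2 := by
    have h1 : ∑ a, ((∑ b, Δ a b) - (Δ a j + Δ a i)) =
        (∑ b, Δ j b + ∑ b, Δ i b) - 2 := by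
      rw [Fintype.sum_eq_add j i hji.ne]
      · simp [hself, hsymm j i, hij]
        ring
      · rintro c ⟨h1, h2⟩
        rw [hrow c h2 h1, sub_self]
    have h2 : ∑ b, Δ j b + ∑ b, Δ i b = 2 * B + 2 := by
      rw [← hG, ← Finset.sum_add_distrib]
      exact Finset.sum_congr rfl fun b _ => by rw [hsymm j b, hsymm i b]
    rw [Finset.sum_sub_distrib, hG, h2] at h1
    linarith
  have hfin : ∑ a, ∑ b, Δ a b = 2 * (inversionNumber π : ℤ) - 2 * inversionNumber π' := by
    simp only [hΔ, Finset.sum_sub_distrib, sum_invPair]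
  linarith

theorem defect_contract_peak {π : Perm (Fin n)} {i j : Fin n} (hj : π j = i) (hji : j < i)
    (hk : π i < i) :
    defect π = defect (contract π i) + 2 * ((i : ℤ) - 1 - max (j : ℤ) (π i : ℕ) -
      ((Finset.univ.filter fun c => j < c ∧ c < i ∧ π i < π c ∧ π c < i).card : ℤ)) := by
  have hD := totalDisplacement_contract hj hji.ne
  have hI := inversionNumber_contract_peak hj hji hk
  have hT := reflectionLength_contract hk.ne
  have hD' : |(i : ℤ) - j| + |((π i : ℕ) : ℤ) - i| - |((π i : ℕ) : ℤ) - j| =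
      2 * ((i : ℤ) - max (j : ℤ) (π i : ℕ)) := by
    rw [Fin.lt_def] at hji hk
    rw [abs_of_pos (by omega), abs_of_neg (by omega)]
    rcases le_total (j : ℕ) (π i : ℕ) with h | h
    · rw [max_eq_right (by omega), abs_of_nonneg (by omega)]; ring
    · rw [max_eq_left (by omega), abs_of_nonpos (by omega)]; ring
  unfold defect
  linarith

theorem card_box_le_cols (π : Perm (Fin n)) {i j k : Fin n} (hji : j < i) :
    ((Finset.univ.filter fun c => j < c ∧ c < i ∧ k < π c ∧ π c < i).card : ℤ) ≤ i - 1 - j := by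
  have h := Finset.card_le_card (s := Finset.univ.filter fun c => j < c ∧ c < i ∧ k < π c ∧ π c < i)
    (t := Finset.Ioo j i) fun c hc => by simp at hc ⊢; exact ⟨hc.1, hc.2.1⟩
  rw [Fin.card_Ioo] at h
  rw [Fin.lt_def] at hji
  omega

/-- Transposing the graph turns counting by values into counting by positions, so the value bounds
below follow from the column bounds for π⁻¹. -/
theorem card_box_inv (π : Perm (Fin n)) (i j k : Fin n) :
    (Finset.univ.filter fun c => j < c ∧ c < i ∧ k < π c ∧ π c < i).card =
    (Finset.univ.filter fun c => k < c ∧ c < i ∧ j < π⁻¹ c ∧ π⁻¹ c < i).card := by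
  refine Finset.card_bij (fun c _ => π c) ?_ ?_ ?_
  · intro a ha; simp at ha ⊢; tauto
  · intro a _ b _ h; exact π.injective h
  · intro b hb
    refine ⟨π⁻¹ b, ?_, by simp⟩
    simp at hb ⊢; tauto

theorem card_box_le_vals (π : Perm (Fin n)) {i j k : Fin n} (hki : k < i) :
    ((Finset.univ.filter fun c => j < c ∧ c < i ∧ k < π c ∧ π c < i).card : ℤ) ≤ i - 1 - k := by
  rw [card_box_inv]
  exact card_box_le_cols π⁻¹ hki

theorem card_box_eq_cols (π : Perm (Fin n)) {i j k : Fin n} (hji : j < i) :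
    ((Finset.univ.filter fun c => j < c ∧ c < i ∧ k < π c ∧ π c < i).card : ℤ) = i - 1 - j ↔
      ∀ c, j < c → c < i → k < π c ∧ π c < i := by
  have hsub : (Finset.univ.filter fun c => j < c ∧ c < i ∧ k < π c ∧ π c < i) ⊆ Finset.Ioo j i :=
    fun c hc => by simp at hc ⊢; exact ⟨hc.1, hc.2.1⟩
  have hcard : ((Finset.Ioo j i).card : ℤ) = i - 1 - j := by
    rw [Fin.card_Ioo]; rw [Fin.lt_def] at hji; omega
  constructor
  · intro h c h1 h2
    have := Finset.eq_of_subset_of_card_le hsub (by omega)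
    have hc : c ∈ Finset.Ioo j i := by simp [h1, h2]
    rw [← this] at hc
    simp at hc
    exact hc.2.2
  · intro h
    rw [← hcard]
    congr 2
    ext c
    simp only [Finset.mem_filter, Finset.mem_univ, true_and, Finset.mem_Ioo]
    constructor
    · tauto
    · rintro ⟨h1, h2⟩; exact ⟨h1, h2, h c h1 h2⟩

theorem card_box_eq_vals (π : Perm (Fin n)) {i j k : Fin n} (hki : k < i) :
    ((Finset.univ.filter fun c => j < c ∧ c < i ∧ k < π c ∧ π c < i).card : ℤ) = i - 1 - k ↔
      ∀ c, k < π c → π c < i → j < c ∧ c < i := by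
  rw [card_box_inv, card_box_eq_cols π⁻¹ hki]
  constructor
  · intro h c h1 h2; simpa using h (π c) h1 h2
  · intro h c h1 h2; exact h (π⁻¹ c) (by simpa using h1) (by simpa using h2)

theorem support_contract_card_lt {π : Perm (Fin n)} {x : Fin n} (hx : π x ≠ x) :
    (contract π x).support.card < π.support.card := by
  refine Finset.card_lt_card ⟨fun c hc => ?_, fun h => ?_⟩
  · rw [mem_support, contract_apply] at hc
    rw [mem_support]
    intro h
    split_ifs at hc with h1 h2
    · exact hc h1.symm
    · exact h1 (h.symm.trans h2)
    · exact hc h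
  · have := h (mem_support.2 hx)
    simp [contract_apply] at this

/-- The Diaconis–Graham inequality `I(π) + T(π) ≤ D(π)`. -/
theorem defect_nonneg (π : Perm (Fin n)) : 0 ≤ defect π := by
  induction hs : π.support.card using Nat.strong_induction_on generalizing π with
  | _ s ih =>
    subst hs
    rcases π.support.eq_empty_or_nonempty with h | h
    · rw [support_eq_empty_iff] at h
      subst h
      have h0 : inversionNumber (1 : Perm (Fin n)) = 0 := by
        refine Finset.sum_eq_zero fun i _ => Finset.card_eq_zero.2 ?_
        exact Finset.filter_eq_empty_iff.2 fun j _ hij => absurd hij.1 (not_lt_of_gt hij.2)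
      simp [defect, totalDisplacement, h0, reflectionLength_one]
    -- The largest non-fixed point is a peak, and contracting it shrinks the support.
    · set i := π.support.max' h with hi
      have him : i ∈ π.support := Finset.max'_mem _ _
      have hle : ∀ c ∈ π.support, c ≤ i := fun c hc => Finset.le_max' _ _ hc
      have hne : π i ≠ i := mem_support.1 him
      have hk : π i < i := lt_of_le_of_ne (hle _ (apply_mem_support.2 him)) hne
      have hj : π (π⁻¹ i) = i := by simp
      have hji : π⁻¹ i < i := by
        refine lt_of_le_of_ne (hle _ ?_) ?_
        · rw [← apply_mem_support, hj]; exact him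
        · intro h; rw [h] at hj; exact hne hj
      have h1 := ih _ (support_contract_card_lt hne) (contract π i) rfl
      have h2 := card_box_le_cols π (k := π i) hji
      have h3 := card_box_le_vals π (j := π⁻¹ i) hk
      rw [defect_contract_peak hj hji hk]
      rcases max_cases ((π⁻¹ i : Fin n) : ℤ) ((π i : ℕ) : ℤ) with h | h <;> omega

/-- The defect is a sum of two nonnegative terms, so it vanishes iff both do. The box term vanishes
iff the box is full along whichever side max(j, π i) makes the shorter. -/
theorem isShallow_peak_iff {π : Perm (Fin n)} {i j : Fin n} (hj : π j = i) (hji : j < i)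
    (hk : π i < i) :
    IsShallow π ↔ IsShallow (contract π i) ∧
      ((π i ≤ j ∧ ∀ c, j < c → c < i → π i < π c ∧ π c < i) ∨
        (j ≤ π i ∧ ∀ c, π i < π c → π c < i → j < c ∧ c < i)) := by
  have h0 := defect_nonneg (contract π i)
  have h1 := defect_contract_peak hj hji hk
  have h2 := card_box_le_cols π (k := π i) hji
  have h3 := card_box_le_vals π (j := j) hk
  rw [isShallow_iff_defect, isShallow_iff_defect, ← card_box_eq_cols π hji,
    ← card_box_eq_vals π hk, Fin.le_def, Fin.le_def]
  rcases max_cases (j : ℤ) ((π i : ℕ) : ℤ) with h | h <;> omega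

theorem reverseComplement_contract (π : Perm (Fin n)) (i : Fin n) :
    reverseComplement (contract π i) = contract (reverseComplement π) i.rev := by
  ext c
  simp only [reverseComplement_apply, contract_apply, Fin.rev_rev]
  have h1 : c.rev = i ↔ c = i.rev := Fin.rev_eq_iff
  have h2 : (π c.rev).rev = i.rev ↔ π c.rev = i := by simp
  simp only [h1, h2]
  split_ifs <;> rfl

theorem isShallow_valley_iff {π : Perm (Fin n)} {i j : Fin n} (hj : π j = i) (hji : i < j)
    (hk : i < π i) :
    IsShallow π ↔ IsShallow (contract π i) ∧
      ((j ≤ π i ∧ ∀ c, i < c → c < j → i < π c ∧ π c < π i) ∨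
        (π i ≤ j ∧ ∀ c, i < π c → π c < π i → i < c ∧ c < j)) := by
  have h := isShallow_peak_iff (π := reverseComplement π) (i := i.rev) (j := j.rev)
    (by simp [reverseComplement_apply, hj]) (by simpa using hji)
    (by simpa [reverseComplement_apply] using hk)
  rw [isShallow_reverseComplement, ← reverseComplement_contract, isShallow_reverseComplement] at h
  rw [h]
  simp only [reverseComplement_apply, Fin.rev_rev, Fin.rev_le_rev, Fin.rev_lt_rev]
  refine and_congr_right fun _ => or_congr (and_congr_right fun _ => ?_)
    (and_congr_right fun _ => ?_)
  · constructor
    · intro h c h1 h2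
      have := h c.rev (by simpa using h2) (by simpa using h1)
      simp only [Fin.rev_rev] at this
      exact this.symm
    · intro h c h1 h2
      exact (h c.rev (Fin.lt_rev_iff.2 h2) (Fin.rev_lt_iff.2 h1)).symm
  · constructor
    · intro h c h1 h2
      have := h c.rev (by simpa using h2) (by simpa using h1)
      simp only [Fin.rev_lt_rev] at this
      exact this.symm
    · intro h c h1 h2
      have := h c.rev h2 h1
      exact ⟨by rw [Fin.rev_lt_iff]; exact this.2, by rw [Fin.lt_rev_iff]; exact this.1⟩

/-! ### Permutations of `Fin n` as functions on `ℕ` -/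

/-- The one-line notation of `π` as a function on `ℕ`, extended by the identity. -/
def fn (π : Perm (Fin n)) (c : ℕ) : ℕ := if h : c < n then π ⟨c, h⟩ else c

theorem fn_val (π : Perm (Fin n)) (c : Fin n) : fn π c = π c := by simp [fn]

theorem fn_of_lt (π : Perm (Fin n)) {c : ℕ} (h : c < n) : fn π c = π ⟨c, h⟩ := by simp [fn, h]

theorem fn_of_le (π : Perm (Fin n)) {c : ℕ} (h : n ≤ c) : fn π c = c := by
  simp [fn, not_lt_of_ge h]

theorem fn_lt_iff (π : Perm (Fin n)) {c : ℕ} : fn π c < n ↔ c < n := by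
  by_cases h : c < n
  · simp [fn, h]
  · simp [fn, h]

theorem fn_injective (π : Perm (Fin n)) : Function.Injective (fn π) := by
  intro a b h
  by_cases ha : a < n
  · have hb : b < n := by rw [← fn_lt_iff π, ← h, fn_lt_iff]; exact ha
    rw [fn_of_lt π ha, fn_of_lt π hb] at h
    simpa using π.injective (Fin.ext h)
  · have hb : ¬ b < n := by rw [← fn_lt_iff π, ← h, fn_lt_iff]; exact ha
    rwa [fn_of_le π (by omega), fn_of_le π (by omega)] at h

theorem fn_surjective (π : Perm (Fin n)) : Function.Surjective (fn π) := by
  intro v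
  by_cases h : v < n
  · refine ⟨π⁻¹ ⟨v, h⟩, ?_⟩
    rw [fn_val]; simp
  · exact ⟨v, fn_of_le π (by omega)⟩

theorem eq_of_fn_eq {π τ : Perm (Fin n)} (h : ∀ c < n, fn π c = fn τ c) : π = τ := by
  ext c
  have := h c c.isLt
  rwa [fn_val, fn_val] at this

theorem fn_contract (π : Perm (Fin n)) {i j : ℕ} (hi : i < n) (hj : fn π j = i) (c : ℕ) :
    fn (contract π ⟨i, hi⟩) c = if c = i then i else if c = j then fn π i else fn π c := by
  by_cases hc : c < n
  · have h1 : π ⟨c, hc⟩ = ⟨i, hi⟩ ↔ c = j := by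
      rw [Fin.ext_iff, ← fn_of_lt]
      exact ⟨fun h => fn_injective π (h.trans hj.symm), fun h => h ▸ hj⟩
    rw [fn_of_lt _ hc, contract_apply, fn_of_lt π hi, fn_of_lt π hc]
    simp only [Fin.ext_iff] at *
    split_ifs <;> simp_all
  · have : c ≠ j := fun h => by
      have := fn_lt_iff π (c := j); omega
    rw [fn_of_le _ (by omega), fn_of_le π (c := c) (by omega), if_neg (by omega), if_neg this]

theorem exists_contract_peak (π : Perm (Fin n)) {i j : ℕ} (hi : i < n) (hj : fn π j = i)
    (hji : j < i) (hk : fn π i < i) : ∃ π' : Perm (Fin n),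
      (∀ c, fn π' c = if c = i then i else if c = j then fn π i else fn π c) ∧
      (IsShallow π ↔ IsShallow π' ∧
        ((fn π i ≤ j ∧ ∀ c, j < c → c < i → fn π i < fn π c ∧ fn π c < i) ∨
          (j ≤ fn π i ∧ ∀ c, fn π i < fn π c → fn π c < i → j < c ∧ c < i))) := by
  refine ⟨contract π ⟨i, hi⟩, fn_contract π hi hj, ?_⟩
  have hjn : j < n := hji.trans hi
  have h := isShallow_peak_iff (π := π) (i := ⟨i, hi⟩) (j := ⟨j, hjn⟩)
    (Fin.ext (by rw [← fn_of_lt]; exact hj)) hji (by rw [Fin.lt_def, ← fn_of_lt]; exact hk)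
  rw [h]
  simp only [Fin.lt_def, Fin.le_def, ← fn_val]
  refine and_congr_right fun _ => or_congr (and_congr_right fun _ => ?_)
    (and_congr_right fun _ => ?_)
  · exact ⟨fun h c h1 h2 => h ⟨c, h2.trans hi⟩ h1 h2, fun h c h1 h2 => h c h1 h2⟩
  · refine ⟨fun h c h1 h2 => ?_, fun h c h1 h2 => h c h1 h2⟩
    have hc : c < n := (fn_lt_iff π).1 (h2.trans hi)
    exact h ⟨c, hc⟩ h1 h2

theorem exists_contract_valley (π : Perm (Fin n)) {i j : ℕ} (hjn : j < n) (hj : fn π j = i)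
    (hji : i < j) (hk : i < fn π i) : ∃ π' : Perm (Fin n),
      (∀ c, fn π' c = if c = i then i else if c = j then fn π i else fn π c) ∧
      (IsShallow π ↔ IsShallow π' ∧
        ((j ≤ fn π i ∧ ∀ c, i < c → c < j → i < fn π c ∧ fn π c < fn π i) ∨
          (fn π i ≤ j ∧ ∀ c, i < fn π c → fn π c < fn π i → i < c ∧ c < j))) := by
  have hi : i < n := hji.trans hjn
  refine ⟨contract π ⟨i, hi⟩, fn_contract π hi hj, ?_⟩
  have h := isShallow_valley_iff (π := π) (i := ⟨i, hi⟩) (j := ⟨j, hjn⟩)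
    (Fin.ext (by rw [← fn_of_lt]; exact hj)) hji (by rw [Fin.lt_def, ← fn_of_lt]; exact hk)
  rw [h]
  simp only [Fin.lt_def, Fin.le_def, ← fn_val]
  refine and_congr_right fun _ => or_congr (and_congr_right fun _ => ?_)
    (and_congr_right fun _ => ?_)
  · exact ⟨fun h c h1 h2 => h ⟨c, h2.trans hjn⟩ h1 h2, fun h c h1 h2 => h c h1 h2⟩
  · refine ⟨fun h c h1 h2 => ?_, fun h c h1 h2 => h c h1 h2⟩
    have hc : c < n := (fn_lt_iff π).1 (h2.trans ((fn_lt_iff π).2 hi))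
    exact h ⟨c, hc⟩ h1 h2

/-- Fixed points fill the box diagonally, so the fullness condition holds whichever of j and π i is
larger. -/
theorem exists_contract_peak_of_fixed (π : Perm (Fin n)) {i j : ℕ} (hi : i < n) (hj : fn π j = i)
    (hji : j < i) (hk : fn π i < i) (hfix : ∀ c, j < c → fn π i < c → c < i → fn π c = c) :
    ∃ π' : Perm (Fin n),
      (∀ c, fn π' c = if c = i then i else if c = j then fn π i else fn π c) ∧
      (IsShallow π' → IsShallow π) := by
  obtain ⟨π', h1, h2⟩ := exists_contract_peak π hi hj hji hk
  refine ⟨π', h1, fun h => h2.2 ⟨h, ?_⟩⟩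
  rcases le_total (fn π i) j with h | h
  · refine Or.inl ⟨h, fun c hc1 hc2 => ?_⟩
    rw [hfix c hc1 (by omega) hc2]; omega
  · refine Or.inr ⟨h, fun c hc1 hc2 => ?_⟩
    have := fn_injective π (hfix (fn π c) (by omega) hc1 hc2)
    omega

theorem exists_contract_valley_of_fixed (π : Perm (Fin n)) {i j : ℕ} (hjn : j < n)
    (hj : fn π j = i) (hji : i < j) (hk : i < fn π i)
    (hfix : ∀ c, c < j → c < fn π i → i < c → fn π c = c) :
    ∃ π' : Perm (Fin n),
      (∀ c, fn π' c = if c = i then i else if c = j then fn π i else fn π c) ∧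
      (IsShallow π' → IsShallow π) := by
  obtain ⟨π', h1, h2⟩ := exists_contract_valley π hjn hj hji hk
  refine ⟨π', h1, fun h => h2.2 ⟨h, ?_⟩⟩
  rcases le_total j (fn π i) with h | h
  · refine Or.inl ⟨h, fun c hc1 hc2 => ?_⟩
    rw [hfix c hc2 (by omega) hc1]; omega
  · refine Or.inr ⟨h, fun c hc1 hc2 => ?_⟩
    have := fn_injective π (hfix (fn π c) (by omega) hc2 hc1)
    omega

theorem fn_reverseComplement_inv (π : Perm (Fin n)) {c : ℕ} (hc : c < n) :
    fn (reverseComplement π)⁻¹ (n - 1 - fn π c) = n - 1 - c := by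
  have h1 : fn π c = π ⟨c, hc⟩ := fn_of_lt π hc
  have h2 : (π ⟨c, hc⟩).rev = reverseComplement π (Fin.rev ⟨c, hc⟩) := by
    simp [reverseComplement_apply]
  have h3 : n - 1 - fn π c = ((π ⟨c, hc⟩).rev : ℕ) := by
    rw [h1, Fin.val_rev]; omega
  rw [h3, fn_val, h2]
  simp [Fin.val_rev]
  omega

/-- Persymmetry is symmetry of the graph in the antidiagonal: the point (c, π c) reflects to (n - 1
- π c, n - 1 - c). -/
theorem isPersymmetric_iff (π : Perm (Fin n)) :
    IsPersymmetric π ↔ ∀ c < n, fn π (n - 1 - fn π c) = n - 1 - c := by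
  constructor
  · intro h c hc
    have := fn_reverseComplement_inv π hc
    unfold IsPersymmetric at h
    rwa [← h] at this
  · intro h
    refine eq_of_fn_eq fun c hc => ?_
    obtain ⟨d, hd⟩ := fn_surjective π (n - 1 - c)
    have hdn : d < n := by rw [← fn_lt_iff π, hd]; omega
    have h1 := h d hdn
    have h2 := fn_reverseComplement_inv π hdn
    have h3 : n - 1 - fn π d = c := by omega
    rw [h3] at h1 h2
    rw [h1, h2]

theorem avoids123_iff (π : Perm (Fin n)) :
    Avoids123 π ↔ ∀ a b c, a < b → b < c → c < n → fn π a < fn π b → fn π c ≤ fn π b := by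
  unfold Avoids123
  constructor
  · intro h a b c hab hbc hc h1
    by_contra h2
    refine h ⟨⟨a, by omega⟩, ⟨b, by omega⟩, ⟨c, hc⟩, hab, hbc, ?_, ?_⟩
    · rw [Fin.lt_def, ← fn_of_lt, ← fn_of_lt]; exact h1
    · rw [Fin.lt_def, ← fn_of_lt, ← fn_of_lt]; omega
  · rintro h ⟨a, b, c, hab, hbc, h1, h2⟩
    have := h a b c hab hbc c.isLt (by rw [fn_val, fn_val]; exact h1)
    rw [fn_val, fn_val] at this
    rw [Fin.lt_def] at h2
    omega

/-! ### Sufficient conditions for shallowness -/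

theorem isShallow_of_forall_fn_eq {π : Perm (Fin n)} (h : ∀ c, fn π c = c) : IsShallow π := by
  have h1 : π = 1 := eq_of_fn_eq fun c hc => by
    rw [h c, fn_of_lt _ hc]; rfl
  have h0 : inversionNumber (1 : Perm (Fin n)) = 0 := by
    refine Finset.sum_eq_zero fun i _ => Finset.card_eq_zero.2 ?_
    exact Finset.filter_eq_empty_iff.2 fun j _ hij => absurd hij.1 (not_lt_of_gt hij.2)
  rw [h1, isShallow_iff_defect]
  simp [defect, totalDisplacement, h0, reflectionLength_one]

/-- A reversed interval can be replaced by fixed points. -/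
theorem exists_straighten (π : Perm (Fin n)) (a b : ℕ) (hb : b < n)
    (h : ∀ c, a ≤ c → c ≤ b → fn π c = a + b - c) : ∃ π' : Perm (Fin n),
      (∀ c, a ≤ c → c ≤ b → fn π' c = c) ∧ (∀ c, c < a ∨ b < c → fn π' c = fn π c) ∧
      (IsShallow π' → IsShallow π) := by
  induction hs : b - a using Nat.strong_induction_on generalizing π a b with
  | _ s ih =>
    by_cases hab : a < b
    · have ha1 := h a le_rfl hab.le
      have hb1 := h b hab.le le_rfl
      -- The endpoints are swapped, so b is a peak whose image and preimage are both a; its box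
      -- contains the whole inner reversal.
      obtain ⟨π₁, h1, h2⟩ := exists_contract_peak π hb (j := a) (by omega) hab (by omega)
      obtain ⟨π₂, h3, h4, h5⟩ := ih (b - 1 - (a + 1)) (by omega) π₁ (a + 1) (b - 1) (by omega)
        (fun c hc1 hc2 => by
          have := h c (by omega) (by omega)
          rw [h1, if_neg (by omega), if_neg (by omega)]; omega) rfl
      refine ⟨π₂, fun c hc1 hc2 => ?_, fun c hc => ?_, fun hπ => h2.2 ⟨h5 hπ, Or.inl ⟨by omega, ?_⟩⟩⟩
      · by_cases hc : a + 1 ≤ c ∧ c ≤ b - 1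
        · exact h3 c hc.1 hc.2
        · rw [h4 c (by omega), h1]
          split_ifs <;> omega
      · rw [h4 c (by omega), h1, if_neg (by omega), if_neg (by omega)]
      · intro c hc1 hc2
        have := h c (by omega) (by omega)
        omega
    · refine ⟨π, fun c hc1 hc2 => ?_, fun c _ => rfl, id⟩
      have := h c hc1 hc2
      omega

/-- The cycle through m spirals outwards: m ↦ hi ↦ lo ↦ hi + 1 ↦ lo - 1 ↦ ⋯. Contracting the peak hi
and then the valley lo leaves m ↦ hi + 1 and the same shape with lo + hi unchanged; everything
inside is already fixed, so the boxes are full. The process ends at hi = B + 1, where lo = A - 1,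
which 1 ≤ A keeps meaningful. -/
theorem exists_unwind_spiral (π : Perm (Fin n)) (A B m lo hi : ℕ) (hA : 1 ≤ A) (hB : B + 1 < n)
    (hsum : lo + hi = A + B) (hlo : lo < m) (hhi : m < hi) (hhB : hi ≤ B + 1)
    (hm : fn π m = hi) (hmid : ∀ c, lo < c → c < hi → c ≠ m → fn π c = c)
    (hhigh : ∀ c, hi ≤ c → c ≤ B → fn π c = A + B - c)
    (hlow : ∀ c, A ≤ c → c ≤ lo → fn π c = A + B + 1 - c) : ∃ π' : Perm (Fin n),
      (∀ c, A ≤ c → c ≤ B → c ≠ m → fn π' c = c) ∧ fn π' m = B + 1 ∧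
      (∀ c, c < A ∨ B < c → fn π' c = fn π c) ∧ (IsShallow π' → IsShallow π) := by
  induction hs : B + 1 - hi generalizing π lo hi with
  | zero =>
    exact ⟨π, fun c h1 h2 h3 => hmid c (by omega) (by omega) h3, by omega, fun c _ => rfl, id⟩
  | succ s ih =>
    have h1 := hhigh hi le_rfl (by omega)
    obtain ⟨π₁, e1, s1⟩ := exists_contract_peak_of_fixed π (i := hi) (j := m) (by omega) hm hhi
      (by omega) (fun c hc1 hc2 hc3 => hmid c (by omega) hc3 (by omega))
    have h2 := hlow lo (by omega) le_rfl
    have h3 : fn π₁ lo = A + B + 1 - lo := by rw [e1, if_neg (by omega), if_neg (by omega), h2]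
    obtain ⟨π₂, e2, s2⟩ := exists_contract_valley_of_fixed π₁ (i := lo) (j := m) (by omega)
      (by rw [e1, if_neg (by omega), if_pos rfl]; omega) hlo (by omega)
      (fun c hc1 hc2 hc3 => by
        rw [e1, if_neg (by omega), if_neg (by omega)]
        exact hmid c (by omega) (by omega) (by omega))
    have key : ∀ c, c ≠ lo → c ≠ hi → c ≠ m → fn π₂ c = fn π c := fun c h4 h5 h6 => by
      rw [e2, if_neg h4, if_neg h6, e1, if_neg h5, if_neg h6]
    obtain ⟨π₃, f1, f2, f3, f4⟩ := ih π₂ (lo - 1) (hi + 1) (by omega) (by omega) (by omega)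
      (by omega)
      (by rw [e2, if_neg (by omega), if_pos rfl]; omega)
      (fun c hc1 hc2 hc3 => by
        by_cases h4 : c = lo
        · rw [e2, if_pos h4]; exact h4.symm
        · by_cases h5 : c = hi
          · rw [e2, if_neg h4, if_neg hc3, e1, if_pos h5]; exact h5.symm
          · rw [key c h4 h5 hc3]; exact hmid c (by omega) (by omega) hc3)
      (fun c hc1 hc2 => by
        rw [key c (by omega) (by omega) (by omega)]; exact hhigh c (by omega) hc2)
      (fun c hc1 hc2 => by
        rw [key c (by omega) (by omega) (by omega)]; exact hlow c hc1 (by omega))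
      (by omega)
    refine ⟨π₃, f1, f2, fun c hc => ?_, fun h => s1 (s2 (f4 h))⟩
    rw [f3 c hc, key c (by omega) (by omega) (by omega)]

/-- A decreasing run whose values skip `m` can be replaced by fixed points,
except that `m` is sent just past the run. -/
theorem exists_straighten_skip (π : Perm (Fin n)) (A B m : ℕ) (hA : 1 ≤ A) (hB : B + 1 < n)
    (hAm : A ≤ m) (hmB : m ≤ B + 1)
    (h : ∀ c, A ≤ c → c ≤ B → fn π c = if c + m ≤ A + B then A + B + 1 - c else A + B - c) :
    ∃ π' : Perm (Fin n),
      (∀ c, A ≤ c → c ≤ B → c ≠ m → fn π' c = c) ∧ (m ≤ B → fn π' m = B + 1) ∧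
      (∀ c, c < A ∨ B < c → fn π' c = fn π c) ∧ (IsShallow π' → IsShallow π) := by
  rcases Nat.eq_or_lt_of_le hmB with hm | hm
  · obtain ⟨π', h1, h2, h3⟩ := exists_straighten π A B (by omega)
      (fun c hc1 hc2 => by rw [h c hc1 hc2, if_neg (by omega)])
    exact ⟨π', fun c hc1 hc2 _ => h1 c hc1 hc2, fun _ => by omega, h2, h3⟩
  · have hπm := h m hAm (by omega)
    by_cases hmm : m + m ≤ A + B
    -- For m in the lower half, the positions m + 1, …, A + B - m form a centred reversal; once it
    -- is straightened, the spiral starts with m ↦ A + B + 1 - m.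
    · rw [if_pos hmm] at hπm
      obtain ⟨π₁, h1, h2, h3⟩ := exists_straighten π (m + 1) (A + B - m) (by omega)
        (fun c hc1 hc2 => by rw [h c (by omega) (by omega), if_pos (by omega)]; omega)
      obtain ⟨π₂, f1, f2, f3, f4⟩ := exists_unwind_spiral π₁ A B m (m - 1) (A + B + 1 - m) hA hB
        (by omega) (by omega) (by omega) (by omega) (by rw [h2 m (by omega), hπm])
        (fun c hc1 hc2 hc3 => h1 c (by omega) (by omega))
        (fun c hc1 hc2 => by
          rw [h2 c (by omega), h c (by omega) hc2, if_neg (by omega)])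
        (fun c hc1 hc2 => by
          rw [h2 c (by omega), h c (by omega) (by omega), if_pos (by omega)])
      refine ⟨π₂, f1, fun _ => f2, fun c hc => ?_, fun hs => h3 (f4 hs)⟩
      rw [f3 c hc, h2 c (by omega)]
    -- For m in the upper half, the spiral first goes down, m ↦ A + B - m ↦ m + 1, so one extra
    -- valley is contracted beforehand.
    · rw [if_neg hmm] at hπm
      obtain ⟨π₁, h1, h2, h3⟩ := exists_straighten π (A + B - m + 1) (m - 1) (by omega)
        (fun c hc1 hc2 => by rw [h c (by omega) (by omega), if_neg (by omega)]; omega)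
      have hlo : fn π₁ (A + B - m) = m + 1 := by
        rw [h2 _ (by omega), h _ (by omega) (by omega), if_pos (by omega)]; omega
      obtain ⟨π₂, e2, s2⟩ := exists_contract_valley_of_fixed π₁ (i := A + B - m) (j := m)
        (by omega) (by rw [h2 m (by omega), hπm]) (by omega) (by omega)
        (fun c hc1 hc2 hc3 => h1 c (by omega) (by omega))
      obtain ⟨π₃, f1, f2, f3, f4⟩ := exists_unwind_spiral π₂ A B m (A + B - m - 1) (m + 1) hA hB
        (by omega) (by omega) (by omega) (by omega)
        (by rw [e2, if_neg (by omega), if_pos rfl, hlo])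
        (fun c hc1 hc2 hc3 => by
          rw [e2]
          split_ifs with h4
          · exact h4.symm
          · exact h1 c (by omega) (by omega))
        (fun c hc1 hc2 => by
          rw [e2, if_neg (by omega), if_neg (by omega), h2 c (by omega), h c (by omega) hc2,
            if_neg (by omega)])
        (fun c hc1 hc2 => by
          rw [e2, if_neg (by omega), if_neg (by omega), h2 c (by omega), h c (by omega) (by omega),
            if_pos (by omega)])
      refine ⟨π₃, f1, fun _ => f2, fun c hc => ?_, fun hs => h3 (s2 (f4 hs))⟩
      rw [f3 c hc, e2, if_neg (by omega), if_neg (by omega), h2 c (by omega)]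

/-- This is the core of an exceptional permutation: a decreasing run skipping m, its antidiagonal
mirror image, and the point n - 1 - m ↦ m joining them. Straightening both runs leaves at most the
cycle m ↦ B + 1 (↦ B + 2 when n is even) ↦ n - 1 - m ↦ m, which is peeled from the top. -/
theorem isShallow_of_skip_runs (ρ : Perm (Fin n)) (A B m : ℕ) (hA : 1 ≤ A) (hAm : A ≤ m)
    (hmB : m ≤ B + 1) (hn : n = 2 * B + 3 ∨ n = 2 * B + 4)
    (hout : ∀ c, c < A ∨ n - 1 - A < c → fn ρ c = c)
    (hrun : ∀ c, A ≤ c → c ≤ B → fn ρ c = if c + m ≤ A + B then A + B + 1 - c else A + B - c)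
    (hdual : ∀ c, A ≤ c → c ≤ B →
      fn ρ (n - 1 - if c + m ≤ A + B then A + B + 1 - c else A + B - c) = n - 1 - c)
    (hK : fn ρ (n - 1 - m) = m) (heven : n = 2 * B + 4 → fn ρ (B + 1) = B + 2) :
    IsShallow ρ := by
  obtain ⟨π, g1, g2, g3, g4⟩ := exists_straighten_skip ρ A B m hA (by omega) hAm hmB hrun
  -- Reflecting in the antidiagonal moves the second run to positions A, …, B, where the same
  -- straightening lemma applies.
  refine g4 ((isShallow_reverseComplement π).1 ((isShallow_inv _).1 ?_))
  set τ := (reverseComplement π)⁻¹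
  have hτ : ∀ x y, x < n → fn π x = y → fn τ (n - 1 - y) = n - 1 - x := fun x y hx hy => by
    rw [← hy]; exact fn_reverseComplement_inv π hx
  obtain ⟨σ, f1, f2, f3, f4⟩ := exists_straighten_skip τ A B m hA (by omega) hAm hmB
    (fun c hc1 hc2 => by
      have h1 := hdual c hc1 hc2
      rw [← g3 _ (by split_ifs <;> omega)] at h1
      have h2 := hτ _ _ (by omega) h1
      rw [show n - 1 - (n - 1 - c) = c by omega] at h2
      rw [h2]
      split_ifs <;> omega)
  refine f4 ?_
  have hfix : ∀ c, c ≠ m → c ≠ B + 1 → c ≠ n - 2 - B → c ≠ n - 1 - m → fn σ c = c := by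
    intro c h1 h2 h3 h4
    by_cases hc : A ≤ c ∧ c ≤ B
    · exact f1 c hc.1 hc.2 h1
    · rw [f3 c (by omega)]
      by_cases hcn : n ≤ c
      · exact fn_of_le _ hcn
      · have h5 : fn π (n - 1 - c) = n - 1 - c := by
          by_cases h6 : A ≤ n - 1 - c ∧ n - 1 - c ≤ B
          · exact g1 _ h6.1 h6.2 (by omega)
          · rw [g3 _ (by omega)]
            exact hout _ (by omega)
        have h6 := hτ _ _ (by omega) h5
        rwa [show n - 1 - (n - 1 - c) = c by omega] at h6
  have hσK : fn σ (n - 1 - m) = m := by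
    rw [f3 _ (by omega)]
    have h1 := hτ (n - 1 - m) m (by omega) (by rw [g3 _ (by omega)]; exact hK)
    omega
  have hσE : n = 2 * B + 4 → fn σ (B + 1) = B + 2 := fun h => by
    rw [f3 _ (by omega)]
    have h1 := hτ (B + 1) (B + 2) (by omega) (by rw [g3 _ (by omega)]; exact heven h)
    rw [show n - 1 - (B + 2) = B + 1 by omega] at h1
    omega
  have hσc : m ≤ B → fn σ (n - 2 - B) = n - 1 - m := fun h => by
    rw [f3 _ (by omega)]
    have h1 := hτ m (B + 1) (by omega) (g2 h)
    rwa [show n - 1 - (B + 1) = n - 2 - B by omega] at h1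
  rcases Nat.lt_or_ge B m with hm | hm
  · have hmB' : m = B + 1 := by omega
    subst hmB'
    rcases hn with hn | hn
    · refine isShallow_of_forall_fn_eq fun c => ?_
      by_cases hc : c = B + 1
      · rw [show n - 1 - (B + 1) = B + 1 by omega] at hσK
        rw [hc, hσK]
      · exact hfix c hc hc (by omega) (by omega)
    · have h1 := hσE hn
      rw [show n - 1 - (B + 1) = B + 2 by omega] at hσK
      obtain ⟨σ₁, e1, s1⟩ := exists_contract_peak_of_fixed σ (i := B + 2) (j := B + 1) (by omega)
        h1 (by omega) (by omega) (fun c _ _ _ => by omega)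
      refine s1 (isShallow_of_forall_fn_eq fun c => ?_)
      rw [e1]
      split_ifs with h2 h3
      · exact h2.symm
      · omega
      · exact hfix c h3 h3 (by omega) (by omega)
  · have h2 := f2 hm
    have h3 := hσc hm
    rcases hn with hn | hn
    · rw [show n - 2 - B = B + 1 by omega] at h3
      obtain ⟨σ₁, e1, s1⟩ := exists_contract_peak_of_fixed σ (i := n - 1 - m) (j := B + 1)
        (by omega) h3 (by omega) (by omega)
        (fun c _ _ _ => hfix c (by omega) (by omega) (by omega) (by omega))
      have e2 : fn σ₁ (B + 1) = m := by rw [e1, if_neg (by omega), if_pos rfl, hσK]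
      obtain ⟨σ₂, e3, s2⟩ := exists_contract_peak_of_fixed σ₁ (i := B + 1) (j := m)
        (by omega) (by rw [e1, if_neg (by omega), if_neg (by omega), h2]) (by omega) (by omega)
        (fun c _ _ _ => by
          rw [e1, if_neg (by omega), if_neg (by omega)]
          exact hfix c (by omega) (by omega) (by omega) (by omega))
      refine s1 (s2 (isShallow_of_forall_fn_eq fun c => ?_))
      rw [e3, e2, e1]
      split_ifs with h4 h5 h6
      · exact h4.symm
      · exact h5.symm
      · exact h6.symm
      · exact hfix c h5 h4 (by omega) h6
    · rw [show n - 2 - B = B + 2 by omega] at h3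
      have h4 := hσE hn
      obtain ⟨σ₁, e1, s1⟩ := exists_contract_peak_of_fixed σ (i := n - 1 - m) (j := B + 2)
        (by omega) h3 (by omega) (by omega)
        (fun c _ _ _ => hfix c (by omega) (by omega) (by omega) (by omega))
      have e2 : fn σ₁ (B + 2) = m := by rw [e1, if_neg (by omega), if_pos rfl, hσK]
      obtain ⟨σ₂, e3, s2⟩ := exists_contract_peak_of_fixed σ₁ (i := B + 2) (j := B + 1)
        (by omega) (by rw [e1, if_neg (by omega), if_neg (by omega), h4]) (by omega) (by omega)
        (fun c _ _ _ => by omega)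
      have e4 : fn σ₂ (B + 1) = m := by rw [e3, if_neg (by omega), if_pos rfl, e2]
      have e5 : ∀ c, c ≠ n - 1 - m → c ≠ B + 2 → c ≠ B + 1 → fn σ₂ c = fn σ c :=
        fun c h5 h6 h7 => by rw [e3, if_neg h6, if_neg h7, e1, if_neg h5, if_neg h6]
      obtain ⟨σ₃, e6, s3⟩ := exists_contract_peak_of_fixed σ₂ (i := B + 1) (j := m)
        (by omega) (by rw [e5 m (by omega) (by omega) (by omega), h2]) (by omega) (by omega)
        (fun c _ _ _ => by
          rw [e5 c (by omega) (by omega) (by omega)]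
          exact hfix c (by omega) (by omega) (by omega) (by omega))
      refine s1 (s2 (s3 (isShallow_of_forall_fn_eq fun c => ?_)))
      rw [e6, e4]
      split_ifs with h5 h6
      · exact h5.symm
      · exact h6.symm
      · by_cases h7 : c = B + 2
        · rw [e3, if_pos h7]; exact h7.symm
        · by_cases h8 : c = n - 1 - m
          · rw [e3, if_neg h7, if_neg h5, e1, if_pos h8]; exact h8.symm
          · rw [e5 c h8 h7 h5]
            exact hfix c h6 h5 (by omega) h8

/-! ### Constructing persymmetric permutations -/

/-- The persymmetry equation says that f composed with reversal is an involution, so bijectivity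
comes for free. -/
theorem exists_perm_of_persymmetric (f : ℕ → ℕ) (hlt : ∀ c < n, f c < n)
    (hp : ∀ c < n, f (n - 1 - f c) = n - 1 - c) :
    ∃ π : Perm (Fin n), (∀ c < n, fn π c = f c) ∧ IsPersymmetric π := by
  have hinv : Function.Involutive fun c : Fin n => (⟨f c.rev, hlt _ c.rev.isLt⟩ : Fin n) := by
    intro c
    have h := hp c.rev c.rev.isLt
    ext
    simp only [Fin.val_rev] at h ⊢
    rw [show n - (f (n - (c + 1)) + 1) = n - 1 - f (n - (c + 1)) by omega, h]
    omega
  have hfn : ∀ c < n, fn (hinv.toPerm * Fin.revPerm) c = f c := by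
    intro c hc
    rw [fn_of_lt _ hc]
    simp only [Perm.mul_apply, Fin.revPerm_apply, Function.Involutive.coe_toPerm, Fin.rev_rev]
  refine ⟨hinv.toPerm * Fin.revPerm, hfn, (isPersymmetric_iff _).2 fun c hc => ?_⟩
  rw [hfn c hc, hfn _ (by have := hlt c hc; omega), hp c hc]

/-- In an increasing triple, the middle position would be both outside and inside R. -/
theorem avoids123_of_two_runs {π : Perm (Fin n)} (R : ℕ → Prop)
    (h : ∀ a b, a < b → b < n → fn π a < fn π b → R a ∧ ¬ R b) : Avoids123 π := by
  rw [avoids123_iff]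
  intro a b c hab hbc hc h1
  by_contra h2
  exact (h a b hab (by omega) h1).2 (h b c hbc hc (by omega)).1

/-! ### The sum of two decreasing permutations -/

/-- One-line notation of the direct sum of two decreasing permutations of size `M`. -/
def twoBlockFn (M c : ℕ) : ℕ := if c < M then M - 1 - c else 3 * M - 1 - c

theorem exists_twoBlock {M : ℕ} (hn : n = 2 * M) : ∃ π : Perm (Fin n),
    (∀ c < n, fn π c = twoBlockFn M c) ∧ IsShallow π ∧ Avoids123 π ∧ IsPersymmetric π := by
  obtain ⟨π, h1, h2⟩ := exists_perm_of_persymmetric (n := n) (twoBlockFn M)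
    (fun c hc => by unfold twoBlockFn; split_ifs <;> omega)
    (fun c hc => by unfold twoBlockFn; split_ifs <;> omega)
  refine ⟨π, h1, ?_, ?_, h2⟩
  · rcases Nat.eq_zero_or_pos M with hM | hM
    · exact isShallow_of_forall_fn_eq fun c => fn_of_le _ (by omega)
    obtain ⟨π₁, f1, f2, f3⟩ := exists_straighten π 0 (M - 1) (by omega) (fun c _ hc => by
      rw [h1 c (by omega), twoBlockFn, if_pos (by omega)]; omega)
    obtain ⟨π₂, g1, g2, g3⟩ := exists_straighten π₁ M (2 * M - 1) (by omega) (fun c _ hc => by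
      rw [f2 c (by omega), h1 c (by omega), twoBlockFn, if_neg (by omega)]; omega)
    refine f3 (g3 (isShallow_of_forall_fn_eq fun c => ?_))
    by_cases hc : n ≤ c
    · exact fn_of_le _ hc
    by_cases hcM : c < M
    · rw [g2 c (by omega)]; exact f1 c (by omega) (by omega)
    · exact g1 c (by omega) (by omega)
  · refine avoids123_of_two_runs (fun c => c < M) fun a b hab hb h => ?_
    rw [h1 a (by omega), h1 b hb] at h
    unfold twoBlockFn at h
    split_ifs at h <;> omega

/-! ### The exceptional family -/

/-- One-line notation, for length `2 * h + e + 1` with `e ≤ 1` and `2 ≤ m ≤ h`, of the shallow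
persymmetric permutations starting with the maximum and ending with `m`, with the minimum
not in the penultimate position. -/
def excFn (h e m c : ℕ) : ℕ :=
  if c = 0 then 2 * h + e
  else if c = 2 * h + e then m
  else if c = 2 * h + e - m then 0
  else if c < 1 + e then 2 * h + e - 1
  else if c < h + e then (if c + m ≤ h + e then h + e + 1 - c else h + e - c)
  else if c < 2 * h + e - m then 3 * h + e - 1 - c
  else 3 * h + e - c

section excFn

variable {h e m c : ℕ}

theorem excFn_zero : excFn h e m 0 = 2 * h + e := by rw [excFn, if_pos rfl]

theorem excFn_last (hm : 2 ≤ m) (hmh : m ≤ h) : excFn h e m (2 * h + e) = m := by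
  rw [excFn, if_neg (by omega), if_pos rfl]

theorem excFn_pos_of_min (hm : 2 ≤ m) (hmh : m ≤ h) : excFn h e m (2 * h + e - m) = 0 := by
  rw [excFn, if_neg (by omega), if_neg (by omega), if_pos rfl]

theorem excFn_one (he : e = 1) (hm : 2 ≤ m) (hmh : m ≤ h) : excFn h e m 1 = 2 * h + e - 1 := by
  rw [excFn, if_neg (by omega), if_neg (by omega), if_neg (by omega), if_pos (by omega)]

theorem excFn_run (he : e ≤ 1) (hmh : m ≤ h) (h1 : 1 + e ≤ c) (h2 : c < h + e) :
    excFn h e m c = if c + m ≤ h + e then h + e + 1 - c else h + e - c := by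
  rw [excFn, if_neg (by omega), if_neg (by omega), if_neg (by omega), if_neg (by omega), if_pos h2]

theorem excFn_high_left (he : e ≤ 1) (hm : 2 ≤ m) (hmh : m ≤ h) (h1 : h + e ≤ c)
    (h2 : c < 2 * h + e - m) : excFn h e m c = 3 * h + e - 1 - c := by
  rw [excFn, if_neg (by omega), if_neg (by omega), if_neg (by omega), if_neg (by omega),
    if_neg (by omega), if_pos h2]

theorem excFn_high_right (he : e ≤ 1) (hmh : m ≤ h) (h1 : 2 * h + e - m < c)
    (h2 : c < 2 * h + e) : excFn h e m c = 3 * h + e - c := by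
  rw [excFn, if_neg (by omega), if_neg (by omega), if_neg (by omega), if_neg (by omega),
    if_neg (by omega), if_neg (by omega)]

theorem excFn_lt (hm : 2 ≤ m) (hmh : m ≤ h) (he : e ≤ 1) : excFn h e m c < 2 * h + e + 1 := by
  unfold excFn; split_ifs <;> omega

/-- A purely linear description of each branch, in a form that `omega` can combine for two positions
at once. -/
theorem excFn_cases (he : e ≤ 1) (hm : 2 ≤ m) (hmh : m ≤ h) (hc : c ≤ 2 * h + e) :
    (c = 0 ∧ excFn h e m c = 2 * h + e) ∨ (c = 2 * h + e ∧ excFn h e m c = m) ∨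
    (c = 2 * h + e - m ∧ excFn h e m c = 0) ∨ (c = 1 ∧ e = 1 ∧ excFn h e m c = 2 * h + e - 1) ∨
    (1 + e ≤ c ∧ c + m ≤ h + e ∧ excFn h e m c = h + e + 1 - c) ∨
    (h + e < c + m ∧ 1 + e ≤ c ∧ c < h + e ∧ excFn h e m c = h + e - c) ∨
    (h + e ≤ c ∧ c < 2 * h + e - m ∧ excFn h e m c = 3 * h + e - 1 - c) ∨
    (2 * h + e - m < c ∧ c < 2 * h + e ∧ excFn h e m c = 3 * h + e - c) := by
  have hcases : c = 0 ∨ c = 2 * h + e ∨ c = 2 * h + e - m ∨ (c = 1 ∧ e = 1) ∨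
      (1 + e ≤ c ∧ c < h + e) ∨ (h + e ≤ c ∧ c < 2 * h + e - m) ∨
      (2 * h + e - m < c ∧ c < 2 * h + e) := by omega
  rcases hcases with h1 | h1 | h1 | ⟨h1, h2⟩ | ⟨h1, h2⟩ | ⟨h1, h2⟩ | ⟨h1, h2⟩
  · exact Or.inl ⟨h1, by rw [h1, excFn_zero]⟩
  · exact Or.inr (Or.inl ⟨h1, by rw [h1, excFn_last hm hmh]⟩)
  · exact Or.inr (Or.inr (Or.inl ⟨h1, by rw [h1, excFn_pos_of_min hm hmh]⟩))
  · exact Or.inr (Or.inr (Or.inr (Or.inl ⟨h1, h2, by rw [h1, excFn_one h2 hm hmh]⟩)))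
  · have h3 := excFn_run he hmh h1 h2
    iterate 4 right
    split_ifs at h3 with h4
    · exact Or.inl ⟨h1, h4, h3⟩
    · exact Or.inr (Or.inl ⟨by omega, h1, h2, h3⟩)
  · iterate 6 right
    exact Or.inl ⟨h1, h2, excFn_high_left he hm hmh h1 h2⟩
  · iterate 7 right
    exact ⟨h1, h2, excFn_high_right he hmh h1 h2⟩

theorem excFn_excFn (he : e ≤ 1) (hm : 2 ≤ m) (hmh : m ≤ h) (hc : c ≤ 2 * h + e) :
    excFn h e m (2 * h + e - excFn h e m c) = 2 * h + e - c := by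
  have hcases : c = 0 ∨ c = 2 * h + e ∨ c = 2 * h + e - m ∨ (c = 1 ∧ e = 1) ∨
      (1 + e ≤ c ∧ c < h + e) ∨ (h + e ≤ c ∧ c < 2 * h + e - m) ∨
      (2 * h + e - m < c ∧ c < 2 * h + e) := by omega
  rcases hcases with h1 | h1 | h1 | ⟨h1, h2⟩ | ⟨h1, h2⟩ | ⟨h1, h2⟩ | ⟨h1, h2⟩
  · rw [h1, excFn_zero, Nat.sub_self, excFn_zero, Nat.sub_zero]
  · rw [h1, excFn_last hm hmh, excFn_pos_of_min hm hmh, Nat.sub_self]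
  · rw [h1, excFn_pos_of_min hm hmh, Nat.sub_zero, excFn_last hm hmh]; omega
  · rw [h1, excFn_one h2 hm hmh, show 2 * h + e - (2 * h + e - 1) = 1 by omega,
      excFn_one h2 hm hmh]
  · rw [excFn_run he hmh h1 h2]
    split_ifs with h3
    · rw [excFn_high_left he hm hmh (by omega) (by omega)]; omega
    · rw [excFn_high_right he hmh (by omega) (by omega)]; omega
  · rw [excFn_high_left he hm hmh h1 h2, excFn_run he hmh (by omega) (by omega),
      if_pos (by omega)]
    omega
  · rw [excFn_high_right he hmh h1 h2, excFn_run he hmh (by omega) (by omega),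
      if_neg (by omega)]
    omega

end excFn

theorem isShallow_of_fn_eq_excFn {π : Perm (Fin n)} {h e m : ℕ} (hn : n = 2 * h + e + 1)
    (he : e ≤ 1) (hm : 2 ≤ m) (hmh : m ≤ h) (hπ : ∀ c < n, fn π c = excFn h e m c) :
    IsShallow π := by
  have p0 : fn π 0 = 2 * h + e := by rw [hπ 0 (by omega), excFn_zero]
  have pK : fn π (2 * h + e - m) = 0 := by rw [hπ _ (by omega), excFn_pos_of_min hm hmh]
  have pl : fn π (2 * h + e) = m := by rw [hπ _ (by omega), excFn_last hm hmh]
  -- The extreme points 0 and 2h + e are peeled first, leaving 2h + e - m ↦ m.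
  obtain ⟨π₁, e1, s1⟩ := exists_contract_valley π (i := 0) (j := 2 * h + e - m) (by omega) pK
    (by omega) (by omega)
  have q1 : fn π₁ (2 * h + e) = m := by rw [e1, if_neg (by omega), if_neg (by omega), pl]
  have q2 : fn π₁ (2 * h + e - m) = 2 * h + e := by rw [e1, if_neg (by omega), if_pos rfl, p0]
  obtain ⟨π₂, e2, s2⟩ := exists_contract_peak π₁ (i := 2 * h + e) (by omega) q2
    (by omega) (by omega)
  have r0 : ∀ c, c ≠ 0 → c ≠ 2 * h + e - m → c ≠ 2 * h + e → fn π₂ c = fn π c :=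
    fun c h1 h2 h3 => by rw [e2, if_neg h3, if_neg h2, e1, if_neg h1, if_neg h2]
  have r1 : fn π₂ 0 = 0 := by rw [e2, if_neg (by omega), if_neg (by omega), e1, if_pos rfl]
  have r2 : fn π₂ (2 * h + e) = 2 * h + e := by rw [e2, if_pos rfl]
  have r3 : fn π₂ (2 * h + e - m) = m := by rw [e2, if_neg (by omega), if_pos rfl, q1]
  have hπ₂ : IsShallow π₂ → IsShallow π := by
    intro hs
    refine s1.2 ⟨s2.2 ⟨hs, Or.inl ⟨by omega, fun c hc1 hc2 => ?_⟩⟩,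
      Or.inl ⟨by omega, fun c hc1 hc2 => ?_⟩⟩
    · rw [q1, e1, if_neg (by omega), if_neg (by omega), hπ c (by omega),
        excFn_high_right he hmh hc1 hc2]
      omega
    · have h1 := (fn_injective π).ne (show c ≠ 0 by omega)
      have h2 := (fn_injective π).ne (show c ≠ 2 * h + e - m by omega)
      have h3 := (fn_lt_iff π (c := c)).2 (by omega)
      omega
  refine hπ₂ ?_
  have hrun : ∀ c, 1 + e ≤ c → c < h + e → fn π₂ c =
      if c + m ≤ h + e then h + e + 1 - c else h + e - c := fun c hc1 hc2 => by
    rw [r0 c (by omega) (by omega) (by omega), hπ c (by omega), excFn_run he hmh hc1 hc2]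
  have hdual : ∀ c, 1 + e ≤ c → c < h + e →
      fn π₂ (2 * h + e - if c + m ≤ h + e then h + e + 1 - c else h + e - c) = 2 * h + e - c := by
    intro c hc1 hc2
    have h1 := excFn_excFn he hm hmh (c := c) (by omega)
    rw [excFn_run he hmh hc1 hc2] at h1
    rw [r0 _ (by split_ifs <;> omega) (by split_ifs <;> omega) (by split_ifs <;> omega),
      hπ _ (by omega), h1]
  rcases Nat.eq_or_lt_of_le he with he1 | he0
  · subst he1
    have t1 : fn π₂ 1 = 2 * h := by
      rw [r0 1 (by omega) (by omega) (by omega), hπ 1 (by omega), excFn_one rfl hm hmh]; omega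
    have t2 : fn π₂ h = 1 := by rw [hrun h (by omega) (by omega), if_neg (by omega)]; omega
    have t3 : fn π₂ (2 * h) = h + 1 := by
      rw [r0 _ (by omega) (by omega) (by omega), hπ _ (by omega),
        excFn_high_right le_rfl hmh (by omega) (by omega)]
      omega
    obtain ⟨π₃, e3, s3⟩ := exists_contract_valley π₂ (i := 1) (j := h) (by omega) t2
      (by omega) (by omega)
    have u1 : fn π₃ h = 2 * h := by rw [e3, if_neg (by omega), if_pos rfl, t1]
    have u2 : fn π₃ (2 * h) = h + 1 := by rw [e3, if_neg (by omega), if_neg (by omega), t3]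
    obtain ⟨π₄, e4, s4⟩ := exists_contract_peak π₃ (i := 2 * h) (by omega) u1
      (by omega) (by omega)
    have v0 : ∀ c, c ≠ 1 → c ≠ h → c ≠ 2 * h → fn π₄ c = fn π₂ c :=
      fun c h1 h2 h3 => by rw [e4, if_neg h3, if_neg h2, e3, if_neg h1, if_neg h2]
    refine s3.2 ⟨s4.2 ⟨?_, Or.inr ⟨by omega, fun c hc1 hc2 => ?_⟩⟩,
      Or.inl ⟨by omega, fun c hc1 hc2 => ?_⟩⟩
    · refine isShallow_of_skip_runs π₄ 2 (h - 1) m (by omega) hm (by omega) (by omega)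
        (fun c hc => ?_) (fun c hc1 hc2 => ?_) (fun c hc1 hc2 => ?_) ?_ (fun _ => ?_)
      · by_cases h1 : c = 1
        · rw [h1, e4, if_neg (by omega), if_neg (by omega), e3, if_pos rfl]
        · by_cases h2 : c = 2 * h
          · rw [h2, e4, if_pos rfl]
          · rw [v0 c h1 (by omega) h2]
            by_cases h3 : c = 0
            · rw [h3, r1]
            · by_cases h4 : c = 2 * h + 1
              · rw [h4, r2]
              · exact fn_of_le _ (by omega)
      · rw [v0 c (by omega) (by omega) (by omega), hrun c (by omega) (by omega)]
        split_ifs <;> omega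
      · have h1 := hdual c (by omega) (by omega)
        rw [show n - 1 - c = 2 * h + 1 - c by omega, ← h1, v0 _ (by split_ifs <;> omega)
          (by split_ifs <;> omega) (by split_ifs <;> omega)]
        congr 1
        split_ifs <;> omega
      · rw [show n - 1 - m = 2 * h + 1 - m by omega, v0 _ (by omega) (by omega) (by omega), r3]
      · rw [show h - 1 + 1 = h by omega, e4, if_neg (by omega), if_pos rfl, u2]
        omega
    · rw [u2] at hc1
      by_contra hcon
      have hcn : c < n := by
        by_contra h1
        rw [fn_of_le π₃ (by omega)] at hc2; omega
      have hch : c ≠ h := fun h1 => by rw [h1, u1] at hc2; omega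
      have hch2 : c ≠ 2 * h := fun h1 => by rw [h1, u2] at hc1; omega
      have hc1' : c ≠ 1 := fun h1 => by rw [h1, e3, if_pos rfl] at hc1; omega
      rw [e3, if_neg hc1', if_neg hch] at hc1 hc2
      have hc0 : c ≠ 0 := fun h1 => by rw [h1, r1] at hc1; omega
      have hcl : c ≠ 2 * h + 1 := fun h1 => by rw [h1, r2] at hc2; omega
      rw [hrun c (by omega) (by omega)] at hc1
      split_ifs at hc1 <;> omega
    · rw [hrun c (by omega) (by omega)]
      split_ifs <;> omega
  · have he2 : e = 0 := by omega
    subst he2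
    refine isShallow_of_skip_runs π₂ 1 (h - 1) m (by omega) (by omega) (by omega) (by omega)
      (fun c hc => ?_) (fun c hc1 hc2 => ?_) (fun c hc1 hc2 => ?_) ?_ (fun _ => by omega)
    · by_cases h3 : c = 0
      · rw [h3, r1]
      · by_cases h4 : c = 2 * h + 0
        · rw [h4, r2]
        · exact fn_of_le _ (by omega)
    · rw [hrun c (by omega) (by omega)]
      split_ifs <;> omega
    · have h1 := hdual c (by omega) (by omega)
      rw [show n - 1 - c = 2 * h + 0 - c by omega, ← h1]
      congr 1
      split_ifs <;> omega
    · rw [show n - 1 - m = 2 * h + 0 - m by omega, r3]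

theorem exists_excPerm {h e m : ℕ} (hn : n = 2 * h + e + 1) (he : e ≤ 1) (hm : 2 ≤ m)
    (hmh : m ≤ h) : ∃ π : Perm (Fin n),
    (∀ c < n, fn π c = excFn h e m c) ∧ IsShallow π ∧ Avoids123 π ∧ IsPersymmetric π := by
  obtain ⟨π, h1, h2⟩ := exists_perm_of_persymmetric (n := n) (excFn h e m)
    (fun c hc => by rw [hn]; exact excFn_lt hm hmh he)
    (fun c hc => by
      subst hn
      exact excFn_excFn he hm hmh (by omega))
  refine ⟨π, h1, isShallow_of_fn_eq_excFn hn he hm hmh h1, ?_, h2⟩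
  -- One decreasing sequence is the left half followed by the minimum; the remaining right half,
  -- ending in m, is the other.
  refine avoids123_of_two_runs (fun c => c < h + e ∨ c = 2 * h + e - m) fun a b hab hb hlt => ?_
  rw [h1 a (by omega), h1 b hb] at hlt
  have hb' := excFn_cases he hm hmh (c := b) (by omega)
  rcases excFn_cases he hm hmh (c := a) (by omega) with ha | ha | ha | ha | ha | ha | ha | ha <;>
    rcases hb' with hb' | hb' | hb' | hb' | hb' | hb' | hb' | hb' <;> omega

/-! ### Decreasing runs -/

/-- A decreasing integer sequence drops by at least one per step. Below, comparing the end values of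
a run with its length determines n and the run itself. -/
theorem add_sub_le_of_decreasing {f : ℕ → ℕ} {a b : ℕ}
    (hf : ∀ c d, a ≤ c → c < d → d ≤ b → f d < f c) {c d : ℕ} (hac : a ≤ c) (hcd : c ≤ d)
    (hdb : d ≤ b) : f d + (d - c) ≤ f c := by
  induction d, hcd using Nat.le_induction with
  | base => simp
  | succ d hcd ih =>
    have h1 := ih (by omega)
    have h2 := hf d (d + 1) (by omega) (by omega) hdb
    omega

/-- The end values allow only S - c or S + 1 - c at each c. A wrong choice at c would propagate
along the run and force the forbidden value m at S - m or S + 1 - m. -/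
theorem eq_of_decreasing_of_skip {f : ℕ → ℕ} {a b m S : ℕ}
    (hf : ∀ c d, a ≤ c → c < d → d ≤ b → f d < f c) (hbS : b ≤ S) (hfa : f a ≤ S + 1 - a)
    (hfb : S - b ≤ f b) (hm : ∀ c, a ≤ c → c ≤ b → f c ≠ m) (hm1 : S - b ≤ m)
    (hm2 : m ≤ S + 1 - a) {c : ℕ} (hac : a ≤ c) (hcb : c ≤ b) :
    f c = if c + m ≤ S then S + 1 - c else S - c := by
  have hup : ∀ d, a ≤ d → d ≤ b → f d ≤ S + 1 - d := fun d h1 h2 => by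
    have := add_sub_le_of_decreasing hf le_rfl h1 h2; omega
  have hlo : ∀ d, a ≤ d → d ≤ b → S - d ≤ f d := fun d h1 h2 => by
    have := add_sub_le_of_decreasing hf h1 h2 le_rfl; omega
  have h1 := hup c hac hcb
  have h2 := hlo c hac hcb
  split_ifs with hcm
  · by_contra hne
    have h3 := hlo (S - m) (by omega) (by omega)
    have h4 := add_sub_le_of_decreasing hf hac (show c ≤ S - m by omega) (by omega)
    exact hm (S - m) (by omega) (by omega) (by omega)
  · by_contra hne
    have h3 := hup (S + 1 - m) (by omega) (by omega)
    have h4 := add_sub_le_of_decreasing hf (show a ≤ S + 1 - m by omega)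
      (show S + 1 - m ≤ c by omega) hcb
    exact hm (S + 1 - m) (by omega) (by omega) (by omega)

/-! ### Structure of shallow persymmetric 123-avoiding permutations -/

/-- The permutations being counted. -/
def IsGood (π : Perm (Fin n)) : Prop := IsShallow π ∧ Avoids123 π ∧ IsPersymmetric π

/-- Avoiding 123 makes the entries before the maximum (position j) and after the minimum (position
K) decreasing. Shallowness puts the minimum left of the maximum, hence immediately before it, and
the two runs are then tight. -/
theorem IsGood.eq_twoBlockFn {π : Perm (Fin n)} (hπ : IsGood π) (hn : 3 ≤ n)
    (h0 : fn π 0 ≠ n - 1) (hl : fn π (n - 1) ≠ 0) :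
    ∃ M, n = 2 * M ∧ ∀ c < n, fn π c = twoBlockFn M c := by
  obtain ⟨hs, hav, hp⟩ := hπ
  rw [avoids123_iff] at hav
  rw [isPersymmetric_iff] at hp
  have inj : ∀ {a b}, fn π a = fn π b → a = b := fun h => fn_injective π h
  have lt : ∀ {c}, c < n → fn π c < n := fun h => (fn_lt_iff π).2 h
  obtain ⟨j, hj⟩ := fn_surjective π (n - 1)
  obtain ⟨K, hK⟩ := fn_surjective π 0
  have hjn : j < n := by rw [← fn_lt_iff π]; omega
  have hKn : K < n := by rw [← fn_lt_iff π]; omega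
  have p0 := hp j hjn
  have pl := hp K hKn
  rw [hj, Nat.sub_self] at p0
  rw [hK, Nat.sub_zero] at pl
  have hj0 : j ≠ 0 := fun h => h0 (h ▸ hj)
  have hK1 : K ≠ n - 1 := fun h => hl (h ▸ hK)
  have hK0 : K ≠ 0 := by
    intro h
    rw [h] at hK
    have h1 := hav 0 1 (n - 1) (by omega) (by omega) (by omega)
      (by rw [hK]; exact Nat.pos_of_ne_zero fun h2 => by have := inj (h2.trans hK.symm); omega)
    have h2 := lt (c := 1) (by omega)
    have := inj (show fn π 1 = fn π (n - 1) by omega)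
    omega
  have hj1 : j ≠ n - 1 := fun h => hK0 (inj (by omega))
  have hbefore : ∀ c d, c < d → d < j → fn π d < fn π c := by
    intro c d hcd hdj
    by_contra hcon
    have h1 : fn π c ≠ fn π d := fun h => by have := inj h; omega
    have h2 := hav c d j hcd hdj hjn (by omega)
    have h3 := lt (c := d) (by omega)
    have := inj (show fn π d = fn π j by omega)
    omega
  have hafter : ∀ c d, K < c → c < d → d < n → fn π d < fn π c := by
    intro c d hc hcd hd
    have h1 : fn π c ≠ 0 := fun h => by have := inj (h.trans hK.symm); omega
    have h2 := hav K c d hc hcd hd (by omega)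
    have h3 : fn π c ≠ fn π d := fun h => by have := inj h; omega
    omega
  -- If j < K, both ways of filling the box of the peak n - 1 fail: position K carries too small a
  -- value, and position 0, left of j, carries n - 1 - j > n - 1 - K = π (n - 1).
  have hKj : K < j := by
    obtain ⟨_, -, h⟩ := exists_contract_peak π (i := n - 1) (j := j) (by omega) hj (by omega)
      (by omega)
    have hne : K ≠ j := fun h => by rw [h] at hK; omega
    by_contra hcon
    rcases (h.1 hs).2 with ⟨-, h1⟩ | ⟨-, h1⟩
    · have := h1 K (by omega) (by omega); omega
    · have := h1 0 (by omega) (by omega); omega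
  have hKj1 : K = j - 1 := by
    by_contra hcon
    have := hbefore K (j - 1) (by omega) (by omega)
    omega
  have d1 := fun {c d} (h1 : c ≤ d) (h2 : d ≤ j - 1) =>
    add_sub_le_of_decreasing (f := fn π) (a := 0) (b := j - 1)
      (fun c d _ h3 h4 => hbefore c d h3 (by omega)) (Nat.zero_le c) h1 h2
  have d2 := fun {c d} (h0 : j ≤ c) (h1 : c ≤ d) (h2 : d ≤ n - 1) =>
    add_sub_le_of_decreasing (f := fn π) (a := j) (b := n - 1)
      (fun c d _ h3 h4 => hafter c d (by omega) h3 (by omega)) h0 h1 h2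
  -- The first run gives 2j ≤ n and the second n ≤ 2j.
  have a1 := d1 (Nat.zero_le (j - 1)) le_rfl
  have a2 := d2 le_rfl (show j ≤ n - 1 by omega) le_rfl
  refine ⟨j, by omega, fun c hc => ?_⟩
  unfold twoBlockFn
  split_ifs with hcj
  · have a3 := d1 (Nat.zero_le c) (by omega)
    have a4 := d1 (show c ≤ j - 1 by omega) le_rfl
    rw [← hKj1] at a4
    omega
  · have a3 := d2 le_rfl (show j ≤ c by omega) (by omega)
    have a4 := d2 (show j ≤ c by omega) (show c ≤ n - 1 by omega) le_rfl
    omega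

/-- The left run determines everything else: antidiagonal reflection carries it onto the two
right-hand stretches. -/
theorem fn_eq_excFn_of_run {π : Perm (Fin n)} {h e m : ℕ} (hn : n = 2 * h + e + 1) (he : e ≤ 1)
    (hm : 2 ≤ m) (hmh : m ≤ h) (hp : IsPersymmetric π) (h0 : fn π 0 = n - 1)
    (hl : fn π (n - 1) = m) (hK : fn π (n - 1 - m) = 0) (h1 : e = 1 → fn π 1 = n - 2)
    (hrun : ∀ c, 1 + e ≤ c → c < h + e →
      fn π c = if c + m ≤ h + e then h + e + 1 - c else h + e - c) :
    ∀ c < n, fn π c = excFn h e m c := by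
  rw [isPersymmetric_iff] at hp
  intro c hc
  have hrefl : ∀ x, 1 + e ≤ x → x < h + e → excFn h e m x = 2 * h + e - c →
      excFn h e m c = 2 * h + e - x → fn π c = excFn h e m c := by
    intro x hx1 hx2 hx3 hx4
    have a1 : fn π x = excFn h e m x := by rw [hrun x hx1 hx2, excFn_run he hmh hx1 hx2]
    have a2 := hp x (by omega)
    rw [a1, hx3, show n - 1 - (2 * h + e - c) = c by omega] at a2
    omega
  have hinv := excFn_excFn he hm hmh (c := c) (by omega)
  rcases excFn_cases he hm hmh (c := c) (by omega) with ⟨a, b⟩ | ⟨a, b⟩ | ⟨a, b⟩ | ⟨a, a', b⟩ |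
      ⟨a, a', b⟩ | ⟨a, a', a'', b⟩ | ⟨a, a', b⟩ | ⟨a, a', b⟩
  · rw [b, a, h0]; omega
  · rw [b, a, ← hl]; congr 1; omega
  · rw [b, a, ← hK]; congr 1; omega
  · rw [b, a, h1 a']; omega
  · rw [b, hrun c a (by omega), if_pos a']
  · rw [b, hrun c a' a'', if_neg (by omega)]
  · exact hrefl _ (by omega) (by omega) hinv (by omega)
  · exact hrefl _ (by omega) (by omega) hinv (by omega)

/-- The case where n - 2 comes right after the minimum. The runs on either side give 2K + 1 ≤ n ≤ 2K
+ 1, so this is the member with e = 0 and m = h = K. -/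
theorem exists_eq_excFn_of_pos_succ_max {π : Perm (Fin n)} (hper : IsPersymmetric π)
    {K m : ℕ} (hm : m = n - 1 - K) (hK2 : 2 ≤ K) (hKn : K < n - 2) (p0 : fn π 0 = n - 1)
    (pl : fn π (n - 1) = m) (hK : fn π K = 0) (h1 : fn π 1 = n - 2 - K)
    (hj : fn π (K + 1) = n - 2) (hlast : 1 ≤ fn π (K - 1))
    (hbefore : ∀ c d, 1 ≤ c → c < d → d ≤ K - 1 → fn π d < fn π c)
    (hafter : ∀ c d, K < c → c < d → d < n → fn π d < fn π c) :
    ∃ h e m, n = 2 * h + e + 1 ∧ e ≤ 1 ∧ 2 ≤ m ∧ m ≤ h ∧ ∀ c < n, fn π c = excFn h e m c := by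
  have a1 := add_sub_le_of_decreasing hbefore le_rfl (show 1 ≤ K - 1 by omega) le_rfl
  have a2 := add_sub_le_of_decreasing (f := fn π) (a := K + 1) (b := n - 1)
    (fun c d h1 h2 h3 => hafter c d (by omega) h2 (by omega)) le_rfl
    (show K + 1 ≤ n - 1 by omega) le_rfl
  have hmK : m = K := by omega
  have hnK : n = 2 * K + 1 := by omega
  refine ⟨K, 0, m, by omega, by omega, by omega, by omega,
    fn_eq_excFn_of_run hnK (by omega) (by omega) (by omega) hper p0 pl
      (by rw [← hK]; congr 1; omega) (by omega) fun c hc1 hc2 => ?_⟩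
  have a3 := add_sub_le_of_decreasing hbefore le_rfl (show 1 ≤ c by omega) (by omega)
  have a4 := add_sub_le_of_decreasing hbefore (show 1 ≤ c by omega) (show c ≤ K - 1 by omega) le_rfl
  rw [if_neg (by omega)]
  omega

/-- The case where the value 1 comes right before n - 2, at position j > 1. The run lengths leave n
= 2j or n = 2j + 1; this gives the members with e = 0 and m < h. -/
theorem exists_eq_excFn_of_min_before_max {π : Perm (Fin n)} (hper : IsPersymmetric π)
    {K m j : ℕ} (hm : m = n - 1 - K) (hj1 : 1 < j) (hjK : j < K) (hKn : K < n - 2)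
    (p0 : fn π 0 = n - 1) (pl : fn π (n - 1) = m) (hK : fn π K = 0) (h1 : fn π 1 = n - 1 - j)
    (hj : fn π j = n - 2) (hL : fn π (j - 1) = 1) (hw : fn π (n - 2) = n - j) (hmw : m < n - j)
    (hbefore : ∀ c d, 1 ≤ c → c < d → d ≤ j - 1 → fn π d < fn π c)
    (hafter : ∀ c d, j ≤ c → c ≠ K → c < d → d < n → fn π d < fn π c)
    (hskip : ∀ c, c < n - 1 → fn π c ≠ m) :
    ∃ h e m, n = 2 * h + e + 1 ∧ e ≤ 1 ∧ 2 ≤ m ∧ m ≤ h ∧ ∀ c < n, fn π c = excFn h e m c := by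
  have hn : n = 2 * j + 1 := by
    have a1 := add_sub_le_of_decreasing hbefore le_rfl (show 1 ≤ j - 1 by omega) le_rfl
    have a2 := add_sub_le_of_decreasing (f := fn π) (a := j) (b := K - 1)
      (fun c d h1 h2 h3 => hafter c d (by omega) (by omega) h2 (by omega)) le_rfl
      (show j ≤ K - 1 by omega) le_rfl
    have a3 := hafter (K - 1) (K + 1) (by omega) (by omega) (by omega) (by omega)
    have a4 := add_sub_le_of_decreasing (f := fn π) (a := K + 1) (b := n - 2)
      (fun c d h1 h2 h3 => hafter c d (by omega) (by omega) h2 (by omega)) le_rfl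
      (show K + 1 ≤ n - 2 by omega) le_rfl
    -- For n = 2j the run on 1, …, j - 1 would be c ↦ j - c without a gap and would take the value
    -- m, which belongs to the last position.
    have hn2 : n ≠ 2 * j := by
      intro hn2
      have b1 := add_sub_le_of_decreasing hbefore le_rfl (show 1 ≤ j - m by omega) (by omega)
      have b2 := add_sub_le_of_decreasing hbefore (show 1 ≤ j - m by omega)
        (show j - m ≤ j - 1 by omega) le_rfl
      exact hskip (j - m) (by omega) (by omega)
    omega
  refine ⟨j, 0, m, by omega, by omega, by omega, by omega,
    fn_eq_excFn_of_run hn (by omega) (by omega) (by omega) hper p0 pl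
      (by rw [← hK]; congr 1; omega) (by omega) fun c hc1 hc2 => ?_⟩
  exact eq_of_decreasing_of_skip hbefore (by omega) (by omega) (by omega)
    (fun c _ h2 => hskip c (by omega)) (by omega) (by omega) (by omega) (by omega)

/-- The case where n - 2 is in position 1, giving e = 1 and h = L. The bounds leave n = 2L + 1 or 2L
+ 2, and the former is excluded because its run would have no room to skip m. -/
theorem exists_eq_excFn_of_max_second {π : Perm (Fin n)} (hper : IsPersymmetric π)
    {K m L : ℕ} (hm : m = n - 1 - K) (hL2 : 2 ≤ L) (hLK : L < K) (hKn : K < n - 2)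
    (p0 : fn π 0 = n - 1) (pl : fn π (n - 1) = m) (hK : fn π K = 0) (h1 : fn π 1 = n - 2)
    (hL : fn π L = 1) (hw : fn π (n - 2) = n - 1 - L) (hLw : L ≤ n - 1 - L) (hmw : m < n - 1 - L)
    (hval : ∀ c, 2 ≤ c → c ≤ L - 1 → 2 ≤ fn π c ∧ fn π c < n - 1 - L)
    (htop : ∀ c, 2 ≤ c → c < n → fn π c ≤ n - 3)
    (hbefore : ∀ c d, 2 ≤ c → c < d → d ≤ L - 1 → fn π d < fn π c)
    (hafter : ∀ c d, L < c → c ≠ K → c < d → d < n → fn π d < fn π c)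
    (hskip : ∀ c, c < n - 1 → fn π c ≠ m) :
    ∃ h e m, n = 2 * h + e + 1 ∧ e ≤ 1 ∧ 2 ≤ m ∧ m ≤ h ∧ ∀ c < n, fn π c = excFn h e m c := by
  have hnle : n ≤ 2 * L + 2 := by
    have a1 := add_sub_le_of_decreasing (f := fn π) (a := K + 1) (b := n - 2)
      (fun c d h1 h2 h3 => hafter c d (by omega) (by omega) h2 (by omega)) le_rfl
      (show K + 1 ≤ n - 2 by omega) le_rfl
    rcases Nat.lt_or_ge (L + 1) K with hlt | hge
    · have a2 := add_sub_le_of_decreasing (f := fn π) (a := L + 1) (b := K - 1)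
        (fun c d h1 h2 h3 => hafter c d (by omega) (by omega) h2 (by omega)) le_rfl
        (show L + 1 ≤ K - 1 by omega) le_rfl
      have a3 := hafter (K - 1) (K + 1) (by omega) (by omega) (by omega) (by omega)
      have a4 := htop (L + 1) (by omega) (by omega)
      omega
    · have a4 := htop (K + 1) (by omega) (by omega)
      omega
  have hn : n = 2 * L + 1 + 1 := by
    have hn2 : n ≠ 2 * L + 1 := by
      intro hn2
      have c1 := hval 2 le_rfl (by omega)
      have c2 := hval (L - 1) (by omega) le_rfl
      have b1 := add_sub_le_of_decreasing hbefore le_rfl (show 2 ≤ L + 1 - m by omega) (by omega)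
      have b2 := add_sub_le_of_decreasing hbefore (show 2 ≤ L + 1 - m by omega)
        (show L + 1 - m ≤ L - 1 by omega) le_rfl
      exact hskip (L + 1 - m) (by omega) (by omega)
    omega
  refine ⟨L, 1, m, by omega, by omega, by omega, by omega,
    fn_eq_excFn_of_run hn (by omega) (by omega) (by omega) hper p0 pl
      (by rw [← hK]; congr 1; omega) (fun _ => h1) fun c hc1 hc2 => ?_⟩
  by_cases hcL : c = L
  · rw [hcL, hL, if_neg (by omega)]; omega
  · have c1 := hval 2 le_rfl (by omega)
    have c2 := hval (L - 1) (by omega) le_rfl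
    exact eq_of_decreasing_of_skip hbefore (by omega) (by omega) (by omega)
      (fun c _ h2 => hskip c (by omega)) (by omega) (by omega) (by omega) (by omega)

theorem exists_eq_excFn_of_max_second_of_box {π : Perm (Fin n)}
    (hav : ∀ a b c, a < b → b < c → c < n → fn π a < fn π b → fn π c ≤ fn π b)
    (hper : IsPersymmetric π)
    {K m L : ℕ} (hm : m = n - 1 - K) (hL2 : 2 ≤ L) (hLK : L < K) (hKn : K < n - 2)
    (p0 : fn π 0 = n - 1) (pl : fn π (n - 1) = m) (hK : fn π K = 0) (h1 : fn π 1 = n - 2)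
    (hL : fn π L = 1) (hw : fn π (n - 2) = n - 1 - L) (hLw : L ≤ n - 1 - L) (hmw : m < n - 1 - L)
    (hbox : ∀ c, 2 ≤ c → c ≠ L → c ≠ K → n - 1 - L < fn π c → fn π c < n - 2 → L < c)
    (hafter : ∀ c d, L < c → c ≠ K → c < d → d < n → fn π d < fn π c)
    (hskip : ∀ c, c < n - 1 → fn π c ≠ m) :
    ∃ h e m, n = 2 * h + e + 1 ∧ e ≤ 1 ∧ 2 ≤ m ∧ m ≤ h ∧ ∀ c < n, fn π c = excFn h e m c := by
  have inj : ∀ {a b}, fn π a = fn π b → a = b := fun h => fn_injective π h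
  have htop : ∀ c, 2 ≤ c → c < n → fn π c ≤ n - 3 := by
    intro c hc1 hc2
    have h2 : fn π c ≠ n - 2 := fun h => by have := inj (h.trans h1.symm); omega
    have h3 : fn π c ≠ n - 1 := fun h => by have := inj (h.trans p0.symm); omega
    have h5 := (fn_lt_iff π (c := c)).2 (by omega)
    omega
  have hval : ∀ c, 2 ≤ c → c ≤ L - 1 → 2 ≤ fn π c ∧ fn π c < n - 1 - L := by
    intro c hc1 hc2
    have h0 : fn π c ≠ 0 := fun h => by have := inj (h.trans hK.symm); omega
    have h1 : fn π c ≠ 1 := fun h => by have := inj (h.trans hL.symm); omega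
    have h4 : fn π c ≠ n - 1 - L := fun h => by have := inj (h.trans hw.symm); omega
    have h5 := htop c hc1 (by omega)
    have h6 := hbox c hc1 (by omega) (by omega)
    omega
  refine exists_eq_excFn_of_max_second hper hm hL2 hLK hKn p0 pl hK h1 hL hw hLw hmw hval htop
    (fun c d h1 h2 h3 => ?_) hafter hskip
  -- The box condition places n - 3 to the right of L, so an ascent inside 2, …, L - 1 would extend
  -- to a 123 ending there.
  obtain ⟨x, hx⟩ := fn_surjective π (n - 3)
  have hxn : x < n := by rw [← fn_lt_iff π]; omega
  have x2 : 2 ≤ x := by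
    by_contra h
    have h' : x = 0 ∨ x = 1 := by omega
    rcases h' with h' | h' <;> rw [h'] at hx <;> omega
  have xL : x ≠ L := fun h => by rw [h] at hx; omega
  have xK : x ≠ K := fun h => by rw [h] at hx; omega
  have h5 := hbox x x2 xL xK (by omega) (by omega)
  have h6 := hval d (by omega) h3
  by_contra hcon
  have h7 : fn π c ≠ fn π d := fun h => by have := inj h; omega
  have h8 := hav c d x h2 (by omega) hxn (by omega)
  omega

/-- The cases follow the position j of the value n - 2: right of the minimum, strictly between 1 and
K, or equal to 1. In the last two, peeling 0 and n - 1 turns n - 2 into the top point (after also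
peeling 1 when j = 1), and its box condition locates L, the position of the value 1. -/
theorem IsGood.eq_excFn {π : Perm (Fin n)} (hπ : IsGood π) (hn : 3 ≤ n) (p0 : fn π 0 = n - 1)
    {K : ℕ} (hK : fn π K = 0) (hKn : K < n - 2) :
    ∃ h e m, n = 2 * h + e + 1 ∧ e ≤ 1 ∧ 2 ≤ m ∧ m ≤ h ∧ ∀ c < n, fn π c = excFn h e m c := by
  obtain ⟨hs, hav, hper⟩ := hπ
  have hp := (isPersymmetric_iff _).1 hper
  rw [avoids123_iff] at hav
  have inj : ∀ {a b}, fn π a = fn π b → a = b := fun h => fn_injective π h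
  have lt : ∀ {c}, c < n → fn π c < n := fun h => (fn_lt_iff π).2 h
  obtain ⟨m, hm⟩ : ∃ m, m = n - 1 - K := ⟨_, rfl⟩
  have pl := hp K (by omega)
  rw [hK, Nat.sub_zero, ← hm] at pl
  have hK0 : K ≠ 0 := fun h => by rw [h] at hK; omega
  obtain ⟨j, hj⟩ := fn_surjective π (n - 2)
  obtain ⟨L, hL⟩ := fn_surjective π 1
  have hjn : j < n := by rw [← fn_lt_iff π]; omega
  have hLn : L < n := by rw [← fn_lt_iff π]; omega
  have p1 := hp j hjn
  rw [hj, show n - 1 - (n - 2) = 1 by omega] at p1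
  have pw := hp L hLn
  rw [hL, show n - 1 - 1 = n - 2 by omega] at pw
  have hj0 : j ≠ 0 := fun h => by rw [h] at hj; omega
  have hL0 : L ≠ 0 := fun h => by rw [h] at hL; omega
  have hjK : j ≠ K := fun h => by rw [h] at hj; omega
  have hafter : ∀ c d, K < c → c < d → d < n → fn π d < fn π c := by
    intro c d hc hcd hd
    have h1 : fn π c ≠ 0 := fun h => by have := inj (h.trans hK.symm); omega
    have h2 := hav K c d hc hcd hd (by omega)
    have h3 : fn π c ≠ fn π d := fun h => by have := inj h; omega
    omega
  have hmw := hafter (n - 2) (n - 1) hKn (by omega) (by omega)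
  have hLK : L < K := by omega
  have hbefore : ∀ c d, 1 ≤ c → c < d → d < j → fn π d < fn π c := by
    intro c d hc hcd hdj
    by_contra hcon
    have h1 : fn π c ≠ fn π d := fun h => by have := inj h; omega
    have h2 := hav c d j hcd hdj hjn (by omega)
    have h3 := lt (c := d) (by omega)
    have h4 : fn π d ≠ n - 2 := fun h => by have := inj (h.trans hj.symm); omega
    have h5 : fn π d ≠ n - 1 := fun h => by have := inj (h.trans p0.symm); omega
    omega
  have hafterL : ∀ c d, L < c → c ≠ K → c < d → d < n → fn π d < fn π c := by
    intro c d hc hcK hcd hd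
    have h0 : fn π c ≠ 0 := fun h => hcK (inj (h.trans hK.symm))
    have h1 : fn π c ≠ 1 := fun h => by have := inj (h.trans hL.symm); omega
    have h2 := hav L c d hc hcd hd (by omega)
    have h3 : fn π c ≠ fn π d := fun h => by have := inj h; omega
    omega
  have hskip : ∀ c, c < n - 1 → fn π c ≠ m := fun c hc h => by
    have := inj (h.trans pl.symm); omega
  rcases Nat.lt_or_ge K j with hKj | hKj
  · have hj1 : j = K + 1 := by
      by_contra hcon
      have h1 := hafter (K + 1) j (by omega) (by omega) hjn
      have h2 := lt (c := K + 1) (by omega)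
      have := inj (show fn π (K + 1) = fn π 0 by omega)
      omega
    have a2 : fn π (K - 1) ≠ 0 := fun h => by have := inj (h.trans hK.symm); omega
    rw [hj1] at hj p1
    exact exists_eq_excFn_of_pos_succ_max hper hm (by omega) hKn p0 pl hK (by omega) hj (by omega)
      (fun c d h1 h2 h3 => hbefore c d h1 h2 (by omega)) hafter
  obtain ⟨π₁, e1, s1⟩ := exists_contract_valley π (i := 0) (j := K) (by omega) hK
    (by omega) (by omega)
  have q1 : fn π₁ (n - 1) = m := by rw [e1, if_neg (by omega), if_neg (by omega), pl]
  have q2 : fn π₁ K = n - 1 := by rw [e1, if_neg (by omega), if_pos rfl, p0]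
  obtain ⟨π₂, e2, s2⟩ := exists_contract_peak π₁ (i := n - 1) (by omega) q2 (by omega) (by omega)
  have r0 : ∀ c, c ≠ 0 → c ≠ K → c ≠ n - 1 → fn π₂ c = fn π c :=
    fun c h1 h2 h3 => by rw [e2, if_neg h3, if_neg h2, e1, if_neg h1, if_neg h2]
  have r3 : fn π₂ K = m := by rw [e2, if_neg (by omega), if_pos rfl, q1]
  have hs₂ : IsShallow π₂ := (s2.1 (s1.1 hs).1).1
  have t1 : fn π₂ 1 = n - 1 - j := by rw [r0 1 (by omega) (by omega) (by omega), p1]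
  have t2 : fn π₂ (n - 2) = n - 1 - L := by rw [r0 _ (by omega) (by omega) (by omega), pw]
  have t3 : fn π₂ j = n - 2 := by rw [r0 _ (by omega) (by omega) (by omega), hj]
  rcases Nat.lt_or_ge 1 j with hj1 | hj1
  · have hLj : L ≠ j := fun h => by rw [h] at hL; omega
    have hL1 : L ≠ 1 := fun h => by rw [h] at hL; omega
    obtain ⟨_, -, s⟩ := exists_contract_peak π₂ (i := n - 2) (by omega) t3 (by omega) (by omega)
    -- The box of the peak n - 2 cannot be full by columns, since position K carries m < n - 1 - L.
    -- If L > j, it cannot be full by values either, because of position 1 with value n - 1 - j.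
    have hLj' : L < j := by
      rcases (s.1 hs₂).2 with ⟨-, h1⟩ | ⟨-, h1⟩
      · have := h1 K (by omega) (by omega); omega
      · by_contra hcon
        have := h1 1 (by omega) (by omega); omega
    have hLj1 : L = j - 1 := by
      by_contra hcon
      have h1 := hbefore L (j - 1) (by omega) (by omega) (by omega)
      have := inj (show fn π (j - 1) = fn π K by omega)
      omega
    subst hLj1
    exact exists_eq_excFn_of_min_before_max hper hm hj1 (by omega) hKn p0 pl hK p1 hj hL
      (by omega) (by omega) (fun c d h1 h2 h3 => hbefore c d h1 h2 (by omega))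
      (fun c d h1 => hafterL c d (by omega)) hskip
  · have hj1' : j = 1 := by omega
    subst hj1'
    have hL1 : L ≠ 1 := fun h => by rw [h] at hL; omega
    obtain ⟨π₃, e3, s3⟩ := exists_contract_valley π₂ (i := 1) (j := L) (by omega)
      (by rw [r0 _ hL0 (by omega) (by omega), hL]) (by omega) (by omega)
    have u1 : fn π₃ L = n - 2 := by rw [e3, if_neg hL1, if_pos rfl, t3]
    have u2 : fn π₃ (n - 2) = n - 1 - L := by rw [e3, if_neg (by omega), if_neg (by omega), t2]
    have u3 : fn π₃ K = m := by rw [e3, if_neg (by omega), if_neg (by omega), r3]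
    have u0 : ∀ c, c ≠ 0 → c ≠ K → c ≠ n - 1 → c ≠ 1 → c ≠ L → fn π₃ c = fn π c :=
      fun c h1 h2 h3 h4 h5 => by rw [e3, if_neg h4, if_neg h5, r0 c h1 h2 h3]
    obtain ⟨_, -, s⟩ := exists_contract_peak π₃ (i := n - 2) (by omega) u1 (by omega) (by omega)
    obtain ⟨hLw, hbox⟩ : L ≤ n - 1 - L ∧
        ∀ c, n - 1 - L < fn π₃ c → fn π₃ c < n - 2 → L < c ∧ c < n - 2 := by
      rw [u2] at s
      rcases (s.1 (s3.1 hs₂).1).2 with ⟨-, h1⟩ | h1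
      · have := h1 K (by omega) (by omega); omega
      · exact h1
    exact exists_eq_excFn_of_max_second_of_box hav hper hm (by omega) hLK hKn p0 pl hK p1 hL pw hLw
      (by omega) (fun c h1 h2 h3 h4 h5 => by
        have h6 : c ≠ n - 1 := fun h => by rw [h] at h4; omega
        rw [← u0 c (by omega) h3 h6 (by omega) h2] at h4 h5
        exact (hbox c h4 h5).1) hafterL hskip

variable {N : ℕ}

/-! ### Symmetry under inversion -/

theorem avoids123_inv {π : Perm (Fin n)} (h : Avoids123 π) : Avoids123 π⁻¹ := by
  rintro ⟨i, j, k, hij, hjk, h1, h2⟩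
  exact h ⟨π⁻¹ i, π⁻¹ j, π⁻¹ k, h1, h2, by simpa using hij, by simpa using hjk⟩

theorem isPersymmetric_inv {π : Perm (Fin n)} (h : IsPersymmetric π) : IsPersymmetric π⁻¹ := by
  unfold IsPersymmetric at *
  have h1 : reverseComplement π⁻¹ = (reverseComplement π)⁻¹ := by
    have : (Fin.revPerm : Perm (Fin n))⁻¹ = Fin.revPerm := rfl
    simp only [reverseComplement, mul_inv_rev, this, mul_assoc]
  rw [h1, ← h]

theorem IsGood.inv {π : Perm (Fin n)} (h : IsGood π) : IsGood π⁻¹ :=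
  ⟨(isShallow_inv π).2 h.1, avoids123_inv h.2.1, isPersymmetric_inv h.2.2⟩

theorem fn_inv_fn (π : Perm (Fin n)) (c : ℕ) : fn π⁻¹ (fn π c) = c := by
  by_cases h : c < n
  · rw [fn_of_lt π h, fn_val]; simp
  · rw [fn_of_le π (by omega), fn_of_le _ (by omega)]

/-! ### Adding a fixed first and last point -/

/-- `Fin N` as the set of interior points of `Fin (N + 2)`. -/
def interiorEquiv (N : ℕ) : Fin N ≃ {i : Fin (N + 2) // 0 < (i : ℕ) ∧ (i : ℕ) < N + 1} where
  toFun i := ⟨⟨i + 1, by omega⟩, by simp⟩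
  invFun i := ⟨i.1 - 1, by have := i.2; omega⟩
  left_inv i := by simp
  right_inv i := by
    have := i.2
    ext
    simp only
    omega

/-- The permutation of `Fin (N + 2)` fixing the first and the last point and
acting as `σ` on the interior. -/
def extendEnds (σ : Perm (Fin N)) : Perm (Fin (N + 2)) := σ.extendDomain (interiorEquiv N)

theorem fn_extendEnds_interior (σ : Perm (Fin N)) {c : ℕ} (h1 : 0 < c) (h2 : c < N + 1) :
    fn (extendEnds σ) c = fn σ (c - 1) + 1 := by
  have h := Perm.extendDomain_apply_subtype σ (interiorEquiv N) (b := ⟨c, by omega⟩) ⟨h1, h2⟩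
  rw [fn_of_lt _ (by omega : c < N + 2), extendEnds, fn_of_lt σ (by omega : c - 1 < N)]
  exact congrArg Fin.val h

theorem fn_extendEnds_of_not (σ : Perm (Fin N)) {c : ℕ} (h : ¬ (0 < c ∧ c < N + 1)) :
    fn (extendEnds σ) c = c := by
  by_cases hc : c < N + 2
  · rw [fn_of_lt _ hc, extendEnds, Perm.extendDomain_apply_not_subtype _ _ (by exact h)]
  · exact fn_of_le _ (by omega)

theorem extendEnds_injective : Function.Injective (extendEnds (N := N)) := by
  intro σ τ h
  refine eq_of_fn_eq fun c hc => ?_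
  have h1 := fn_extendEnds_interior σ (c := c + 1) (by omega) (by omega)
  have h2 := fn_extendEnds_interior τ (c := c + 1) (by omega) (by omega)
  rw [h, h2] at h1
  simpa using h1.symm

theorem exists_extendEnds_eq (ρ : Perm (Fin (N + 2))) (h0 : fn ρ 0 = 0)
    (hl : fn ρ (N + 1) = N + 1) : ∃ σ, extendEnds σ = ρ := by
  have key : ∀ (τ : Perm (Fin (N + 2))), fn τ 0 = 0 → fn τ (N + 1) = N + 1 → ∀ c, 0 < c →
      c < N + 1 → 0 < fn τ c ∧ fn τ c < N + 1 := by
    intro τ h1 h2 c hc1 hc2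
    have h3 := (fn_injective τ).ne (show c ≠ 0 by omega)
    have h4 := (fn_injective τ).ne (show c ≠ N + 1 by omega)
    have h5 := (fn_lt_iff τ (c := c)).2 (by omega)
    omega
  have hinv0 : fn ρ⁻¹ 0 = 0 := by have := fn_inv_fn ρ 0; rwa [h0] at this
  have hinvl : fn ρ⁻¹ (N + 1) = N + 1 := by have := fn_inv_fn ρ (N + 1); rwa [hl] at this
  have hfi : ∀ c, fn ρ (fn ρ⁻¹ c) = c := fun c => by
    have := fn_inv_fn ρ⁻¹ c; rwa [inv_inv] at this
  let σ : Perm (Fin N) :=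
    { toFun := fun i => ⟨fn ρ (i + 1) - 1, by
        have := key ρ h0 hl (i + 1) (by omega) (by omega); omega⟩
      invFun := fun i => ⟨fn ρ⁻¹ (i + 1) - 1, by
        have := key ρ⁻¹ hinv0 hinvl (i + 1) (by omega) (by omega); omega⟩
      left_inv := fun i => by
        have h1 := key ρ h0 hl (i + 1) (by omega) (by omega)
        ext
        simp only
        rw [show fn ρ (i + 1) - 1 + 1 = fn ρ (i + 1) by omega, fn_inv_fn]
        rfl
      right_inv := fun i => by
        have h1 := key ρ⁻¹ hinv0 hinvl (i + 1) (by omega) (by omega)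
        ext
        simp only
        rw [show fn ρ⁻¹ (i + 1) - 1 + 1 = fn ρ⁻¹ (i + 1) by omega, hfi]
        rfl }
  refine ⟨σ, eq_of_fn_eq fun c hc => ?_⟩
  by_cases h : 0 < c ∧ c < N + 1
  · have h1 := key ρ h0 hl c h.1 h.2
    rw [fn_extendEnds_interior σ h.1 h.2, fn_of_lt σ (by omega : c - 1 < N)]
    change fn ρ (c - 1 + 1) - 1 + 1 = _
    rw [show c - 1 + 1 = c by omega]
    omega
  · rw [fn_extendEnds_of_not σ h]
    rcases (show c = 0 ∨ c = N + 1 by omega) with h | h <;> rw [h]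
    · exact h0.symm
    · exact hl.symm

theorem totalDisplacement_eq_sum_range (π : Perm (Fin n)) :
    totalDisplacement π = ∑ c ∈ Finset.range n, |(fn π c : ℤ) - c| := by
  rw [← Fin.sum_univ_eq_sum_range (fun c => |(fn π c : ℤ) - c|) n]
  simp only [totalDisplacement, fn_val]

theorem inversionNumber_eq_sum_range (π : Perm (Fin n)) :
    inversionNumber π = ∑ a ∈ Finset.range n, ∑ b ∈ Finset.range n,
      if a < b ∧ fn π b < fn π a then 1 else 0 := by
  rw [← Fin.sum_univ_eq_sum_range
    (fun a => ∑ b ∈ Finset.range n, if a < b ∧ fn π b < fn π a then 1 else 0) n]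
  unfold inversionNumber
  refine Finset.sum_congr rfl fun a _ => ?_
  rw [← Fin.sum_univ_eq_sum_range (fun b => if (a : ℕ) < b ∧ fn π b < fn π a then 1 else 0) n,
    Finset.card_filter]
  simp only [fn_val, Fin.lt_def]

/-- The added points are fixed and extremal, hence in no inversion, so D, I and T are all unchanged.
-/
theorem isShallow_extendEnds (σ : Perm (Fin N)) : IsShallow (extendEnds σ) ↔ IsShallow σ := by
  have h0 : fn (extendEnds σ) 0 = 0 := fn_extendEnds_of_not σ (by omega)
  have hl : fn (extendEnds σ) (N + 1) = N + 1 := fn_extendEnds_of_not σ (by omega)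
  have hi : ∀ c ∈ Finset.range N, fn (extendEnds σ) (c + 1) = fn σ c + 1 := fun c hc => by
    rw [Finset.mem_range] at hc
    rw [fn_extendEnds_interior σ (by omega) (by omega), Nat.add_sub_cancel]
  have hT : reflectionLength (extendEnds σ) = reflectionLength σ := by
    rw [reflectionLength_eq, reflectionLength_eq, extendEnds, cycleType_extendDomain,
      card_support_extend_domain]
  have hD : totalDisplacement (extendEnds σ) = totalDisplacement σ := by
    rw [totalDisplacement_eq_sum_range, totalDisplacement_eq_sum_range, Finset.sum_range_succ,
      Finset.sum_range_succ', h0, hl, sub_self, sub_self, abs_zero, add_zero, add_zero]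
    refine Finset.sum_congr rfl fun c hc => ?_
    rw [hi c hc]
    push_cast
    rw [add_sub_add_right_eq_sub]
  have hI : inversionNumber (extendEnds σ) = inversionNumber σ := by
    have hlt : ∀ c ∈ Finset.range N, fn σ c < N := fun c hc =>
      (fn_lt_iff σ).2 (Finset.mem_range.1 hc)
    have hrow : ∀ a ∈ Finset.range N, (∑ b ∈ Finset.range (N + 2),
        if a + 1 < b ∧ fn (extendEnds σ) b < fn (extendEnds σ) (a + 1) then 1 else 0) =
        ∑ b ∈ Finset.range N, if a < b ∧ fn σ b < fn σ a then 1 else 0 := by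
      intro a ha
      have := hlt a ha
      rw [Finset.sum_range_succ, Finset.sum_range_succ', h0, hl, hi a ha, if_neg (by omega),
        if_neg (by omega), add_zero, add_zero]
      refine Finset.sum_congr rfl fun b hb => if_congr ?_ rfl rfl
      rw [hi b hb]
      omega
    rw [inversionNumber_eq_sum_range, inversionNumber_eq_sum_range, Finset.sum_range_succ,
      Finset.sum_range_succ', Finset.sum_congr rfl hrow, h0, hl]
    rw [Finset.sum_eq_zero fun b _ => if_neg (by omega), Finset.sum_eq_zero fun b hb =>
      if_neg (by rw [Finset.mem_range] at hb; omega), add_zero, add_zero]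
  unfold IsShallow
  rw [hT, hD, hI]

theorem fn_swap_mul (ρ : Perm (Fin n)) {x y : ℕ} (hx : x < n) (hy : y < n) (c : ℕ) :
    fn (swap ⟨x, hx⟩ ⟨y, hy⟩ * ρ) c =
      if fn ρ c = x then y else if fn ρ c = y then x else fn ρ c := by
  by_cases hc : c < n
  · rw [fn_of_lt _ hc, fn_of_lt ρ hc, Perm.mul_apply, swap_apply_def]
    simp only [Fin.ext_iff]
    split_ifs <;> rfl
  · rw [fn_of_le _ (by omega), fn_of_le ρ (by omega), if_neg (by omega), if_neg (by omega)]

/-! ### Permutations starting with the maximum and ending with the minimum -/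

/-- The permutation `(N + 1) σ 0`. -/
def wrap (σ : Perm (Fin N)) : Perm (Fin (N + 2)) :=
  swap ⟨0, by omega⟩ ⟨N + 1, by omega⟩ * extendEnds σ

theorem wrap_injective : Function.Injective (wrap (N := N)) := fun _ _ h =>
  extendEnds_injective (mul_left_cancel h)

theorem fn_wrap_zero (σ : Perm (Fin N)) : fn (wrap σ) 0 = N + 1 := by
  rw [wrap, fn_swap_mul, fn_extendEnds_of_not σ (by omega), if_pos rfl]

theorem fn_wrap_last (σ : Perm (Fin N)) : fn (wrap σ) (N + 1) = 0 := by
  rw [wrap, fn_swap_mul, fn_extendEnds_of_not σ (by omega), if_neg (by omega), if_pos rfl]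

theorem fn_wrap_interior (σ : Perm (Fin N)) {c : ℕ} (h1 : 0 < c) (h2 : c < N + 1) :
    fn (wrap σ) c = fn σ (c - 1) + 1 := by
  have := (fn_lt_iff σ (c := c - 1)).2 (by omega)
  rw [wrap, fn_swap_mul, fn_extendEnds_interior σ h1 h2, if_neg (by omega), if_neg (by omega)]

/-- Contracting the maximum yields `extendEnds σ`, and its box is the whole interior, hence full. -/
theorem isShallow_wrap (σ : Perm (Fin N)) : IsShallow (wrap σ) ↔ IsShallow σ := by
  obtain ⟨π, h1, h2⟩ := exists_contract_peak (wrap σ) (i := N + 1) (by omega) (fn_wrap_zero σ)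
    (by omega) (by rw [fn_wrap_last]; omega)
  have h3 : π = extendEnds σ := by
    refine eq_of_fn_eq fun c hc => ?_
    rw [h1, fn_wrap_last]
    by_cases h : 0 < c ∧ c < N + 1
    · rw [if_neg (by omega), if_neg (by omega), fn_wrap_interior σ h.1 h.2,
        fn_extendEnds_interior σ h.1 h.2]
    · rw [fn_extendEnds_of_not σ h]
      split_ifs <;> omega
  rw [h2, h3, isShallow_extendEnds]
  refine and_iff_left (Or.inl ⟨by rw [fn_wrap_last], fun c hc1 hc2 => ?_⟩)
  have := (fn_lt_iff σ (c := c - 1)).2 (by omega)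
  rw [fn_wrap_last, fn_wrap_interior σ hc1 hc2]
  omega

theorem isPersymmetric_wrap (σ : Perm (Fin N)) : IsPersymmetric (wrap σ) ↔ IsPersymmetric σ := by
  rw [isPersymmetric_iff, isPersymmetric_iff]
  have key : ∀ c < N, fn (wrap σ) (N + 2 - 1 - fn (wrap σ) (c + 1)) =
      fn σ (N - 1 - fn σ c) + 1 := by
    intro c hc
    have := (fn_lt_iff σ (c := c)).2 hc
    have h1 := fn_wrap_interior σ (c := c + 1) (by omega) (by omega)
    rw [Nat.add_sub_cancel] at h1
    rw [h1, fn_wrap_interior σ (by omega) (by omega)]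
    congr 2
    omega
  constructor
  · intro h c hc
    have h1 := h (c + 1) (by omega)
    rw [key c hc] at h1
    omega
  · intro h c hc
    by_cases hi : 0 < c ∧ c < N + 1
    · have h1 := key (c - 1) (by omega)
      rw [h (c - 1) (by omega), show c - 1 + 1 = c by omega] at h1
      omega
    · rcases (show c = 0 ∨ c = N + 1 by omega) with h | h <;> rw [h]
      · rw [fn_wrap_zero, show N + 2 - 1 - (N + 1) = 0 by omega, fn_wrap_zero]; rfl
      · rw [fn_wrap_last, show N + 2 - 1 - 0 = N + 1 by omega, fn_wrap_last]; omega

theorem avoids123_wrap (σ : Perm (Fin N)) : Avoids123 (wrap σ) ↔ Avoids123 σ := by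
  rw [avoids123_iff, avoids123_iff]
  have hin : ∀ c < N, fn (wrap σ) (c + 1) = fn σ c + 1 := fun c hc => by
    rw [fn_wrap_interior σ (by omega) (by omega), Nat.add_sub_cancel]
  constructor
  · intro h a b c hab hbc hc h1
    have h2 := h (a + 1) (b + 1) (c + 1) (by omega) (by omega) (by omega)
    rw [hin a (by omega), hin b (by omega), hin c hc] at h2
    omega
  · intro h a b c hab hbc hc h1
    have hlt := fun d => (fn_lt_iff (wrap σ) (c := d))
    by_cases ha : a = 0
    · rw [ha, fn_wrap_zero] at h1
      have := (hlt b).2 (by omega)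
      omega
    by_cases hcl : c = N + 1
    · rw [hcl, fn_wrap_last]; omega
    have h2 := h (a - 1) (b - 1) (c - 1) (by omega) (by omega) (by omega)
    rw [fn_wrap_interior σ (c := a) (by omega) (by omega),
      fn_wrap_interior σ (c := b) (by omega) (by omega)] at h1
    rw [fn_wrap_interior σ (c := b) (by omega) (by omega),
      fn_wrap_interior σ (c := c) (by omega) (by omega)]
    have := h2 (by omega)
    omega

theorem isGood_wrap (σ : Perm (Fin N)) : IsGood (wrap σ) ↔ IsGood σ := by
  rw [IsGood, IsGood, isShallow_wrap, avoids123_wrap, isPersymmetric_wrap]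

theorem exists_wrap_eq (π : Perm (Fin (N + 2))) (h0 : fn π 0 = N + 1) (hl : fn π (N + 1) = 0) :
    ∃ σ, wrap σ = π := by
  obtain ⟨σ, hσ⟩ := exists_extendEnds_eq (swap ⟨0, by omega⟩ ⟨N + 1, by omega⟩ * π)
    (by rw [fn_swap_mul, h0, if_neg (by omega), if_pos rfl])
    (by rw [fn_swap_mul, hl, if_pos rfl])
  exact ⟨σ, by rw [wrap, hσ, ← mul_assoc, swap_mul_self, one_mul]⟩

/-! ### Permutations starting with the maximum and ending with the two smallest values -/

/-- For `σ = σ' 0`, the permutation `(N + 1) σ' 0 1`, the values of `σ'` being shifted by one. -/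
def wrapTwo (σ : Perm (Fin N)) : Perm (Fin (N + 2)) :=
  swap ⟨0, by omega⟩ ⟨N + 1, by omega⟩ * (swap ⟨N + 1, by omega⟩ ⟨1, by omega⟩ * extendEnds σ)

theorem wrapTwo_injective : Function.Injective (wrapTwo (N := N)) := fun _ _ h =>
  extendEnds_injective (mul_left_cancel (mul_left_cancel h))


theorem fn_wrapTwo (σ : Perm (Fin N)) (hN : 1 ≤ N) (c : ℕ) : fn (wrapTwo σ) c =
    if fn (extendEnds σ) c = 0 then N + 1 else if fn (extendEnds σ) c = N + 1 then 1
    else if fn (extendEnds σ) c = 1 then 0 else fn (extendEnds σ) c := by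
  rw [wrapTwo, fn_swap_mul, fn_swap_mul]
  grind

section wrapTwo

variable {σ : Perm (Fin N)} {c : ℕ}

theorem fn_wrapTwo_zero (hN : 1 ≤ N) : fn (wrapTwo σ) 0 = N + 1 := by
  rw [fn_wrapTwo σ hN, fn_extendEnds_of_not σ (by omega), if_pos rfl]

theorem fn_wrapTwo_last (hN : 1 ≤ N) : fn (wrapTwo σ) (N + 1) = 1 := by
  rw [fn_wrapTwo σ hN, fn_extendEnds_of_not σ (by omega), if_neg (by omega), if_pos rfl]

theorem fn_wrapTwo_penultimate (hN : 1 ≤ N) (hσ : fn σ (N - 1) = 0) :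
    fn (wrapTwo σ) N = 0 := by
  rw [fn_wrapTwo σ hN, fn_extendEnds_interior σ (by omega) (by omega), hσ, if_neg (by omega),
    if_neg (by omega), if_pos rfl]

theorem fn_pos_of_last (hN : 1 ≤ N) (hσ : fn σ (N - 1) = 0) (hc : c < N - 1) :
    0 < fn σ c ∧ fn σ c < N := by
  have h1 := (fn_lt_iff σ (c := c)).2 (by omega)
  have h2 := (fn_injective σ).ne (show c ≠ N - 1 by omega)
  omega

theorem fn_wrapTwo_interior (hN : 1 ≤ N) (hσ : fn σ (N - 1) = 0) (h1 : 0 < c) (h2 : c < N) :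
    fn (wrapTwo σ) c = fn σ (c - 1) + 1 := by
  have := fn_pos_of_last hN hσ (show c - 1 < N - 1 by omega)
  rw [fn_wrapTwo σ hN, fn_extendEnds_interior σ h1 (by omega), if_neg (by omega),
    if_neg (by omega), if_neg (by omega)]

/-- Contracting the valley 0 and then the peak N + 1 yields `extendEnds σ`; the first box is full
and the second has no columns. -/
theorem isShallow_wrapTwo (hN : 1 ≤ N) (hσ : fn σ (N - 1) = 0) :
    IsShallow (wrapTwo σ) ↔ IsShallow σ := by
  have w0 := fn_wrapTwo_zero (σ := σ) hN
  have wl := fn_wrapTwo_last (σ := σ) hN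
  have wp := fn_wrapTwo_penultimate hN hσ
  obtain ⟨π₁, e1, s1⟩ := exists_contract_valley (wrapTwo σ) (i := 0) (j := N) (by omega) wp
    (by omega) (by omega)
  have q1 : fn π₁ (N + 1) = 1 := by rw [e1, if_neg (by omega), if_neg (by omega), wl]
  have q2 : fn π₁ N = N + 1 := by rw [e1, if_neg (by omega), if_pos rfl, w0]
  obtain ⟨π₂, e2, s2⟩ := exists_contract_peak π₁ (i := N + 1) (by omega) q2
    (by omega) (by omega)
  have h3 : π₂ = extendEnds σ := by
    refine eq_of_fn_eq fun c hc => ?_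
    by_cases h : 0 < c ∧ c < N
    · rw [e2, if_neg (by omega), if_neg (by omega), e1, if_neg (by omega), if_neg (by omega),
        fn_wrapTwo_interior hN hσ h.1 h.2, fn_extendEnds_interior σ h.1 (by omega)]
    · rcases (show c = 0 ∨ c = N ∨ c = N + 1 by omega) with h | h | h <;> rw [h]
      · rw [e2, if_neg (by omega), if_neg (by omega), e1, if_pos rfl,
          fn_extendEnds_of_not σ (by omega)]
      · rw [e2, if_neg (by omega), if_pos rfl, q1, fn_extendEnds_interior σ (by omega) (by omega),
          hσ]
      · rw [e2, if_pos rfl, fn_extendEnds_of_not σ (by omega)]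
  rw [s1, s2, h3, isShallow_extendEnds]
  rw [and_iff_left, and_iff_left]
  · exact Or.inl ⟨by omega, fun c hc1 hc2 => by omega⟩
  · refine Or.inl ⟨by omega, fun c hc1 hc2 => ?_⟩
    have := fn_pos_of_last hN hσ (show c - 1 < N - 1 by omega)
    rw [w0, fn_wrapTwo_interior hN hσ hc1 hc2]
    omega

theorem isPersymmetric_wrapTwo (hN : 1 ≤ N) (hσ : fn σ (N - 1) = 0) :
    IsPersymmetric (wrapTwo σ) ↔ IsPersymmetric σ := by
  rw [isPersymmetric_iff, isPersymmetric_iff]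
  have key : ∀ c < N - 1, fn (wrapTwo σ) (N + 2 - 1 - fn (wrapTwo σ) (c + 1)) =
      fn σ (N - 1 - fn σ c) + 1 := by
    intro c hc
    have := fn_pos_of_last hN hσ hc
    have h1 := fn_wrapTwo_interior hN hσ (c := c + 1) (by omega) (by omega)
    rw [Nat.add_sub_cancel] at h1
    rw [h1, fn_wrapTwo_interior hN hσ (by omega) (by omega)]
    congr 2
    omega
  constructor
  · intro h c hc
    by_cases hcl : c = N - 1
    · rw [hcl, hσ, Nat.sub_zero, hσ, Nat.sub_self]
    · have h1 := h (c + 1) (by omega)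
      rw [key c (by omega)] at h1
      omega
  · intro h c hc
    by_cases hi : 0 < c ∧ c < N
    · have h1 := key (c - 1) (by omega)
      rw [h (c - 1) (by omega), show c - 1 + 1 = c by omega] at h1
      omega
    · rcases (show c = 0 ∨ c = N ∨ c = N + 1 by omega) with h | h | h <;> rw [h]
      · rw [fn_wrapTwo_zero hN, show N + 2 - 1 - (N + 1) = 0 by omega, fn_wrapTwo_zero hN]; rfl
      · rw [fn_wrapTwo_penultimate hN hσ, show N + 2 - 1 - 0 = N + 1 by omega, fn_wrapTwo_last hN]
        omega
      · rw [fn_wrapTwo_last hN, show N + 2 - 1 - 1 = N by omega, fn_wrapTwo_penultimate hN hσ]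
        omega

theorem avoids123_wrapTwo (hN : 1 ≤ N) (hσ : fn σ (N - 1) = 0) :
    Avoids123 (wrapTwo σ) ↔ Avoids123 σ := by
  rw [avoids123_iff, avoids123_iff]
  have hin : ∀ c < N - 1, fn (wrapTwo σ) (c + 1) = fn σ c + 1 := fun c hc => by
    rw [fn_wrapTwo_interior hN hσ (by omega) (by omega), Nat.add_sub_cancel]
  constructor
  · intro h a b c hab hbc hc h1
    by_cases hcl : c = N - 1
    · rw [hcl, hσ]; omega
    have h2 := h (a + 1) (b + 1) (c + 1) (by omega) (by omega) (by omega)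
    rw [hin a (by omega), hin b (by omega), hin c (by omega)] at h2
    omega
  · intro h a b c hab hbc hc h1
    by_cases ha : a = 0
    · rw [ha, fn_wrapTwo_zero hN] at h1
      have := (fn_lt_iff (wrapTwo σ) (c := b)).2 (by omega)
      omega
    by_cases hcl : c = N + 1
    · rw [hcl, fn_wrapTwo_last hN]; omega
    by_cases hcp : c = N
    · rw [hcp, fn_wrapTwo_penultimate hN hσ]; omega
    have h2 := h (a - 1) (b - 1) (c - 1) (by omega) (by omega) (by omega)
    rw [fn_wrapTwo_interior hN hσ (c := a) (by omega) (by omega),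
      fn_wrapTwo_interior hN hσ (c := b) (by omega) (by omega)] at h1
    rw [fn_wrapTwo_interior hN hσ (c := b) (by omega) (by omega),
      fn_wrapTwo_interior hN hσ (c := c) (by omega) (by omega)]
    have := h2 (by omega)
    omega

theorem isGood_wrapTwo (hN : 1 ≤ N) (hσ : fn σ (N - 1) = 0) :
    IsGood (wrapTwo σ) ↔ IsGood σ := by
  rw [IsGood, IsGood, isShallow_wrapTwo hN hσ, avoids123_wrapTwo hN hσ,
    isPersymmetric_wrapTwo hN hσ]

end wrapTwo

theorem exists_wrapTwo_eq (hN : 1 ≤ N) (π : Perm (Fin (N + 2))) (h0 : fn π 0 = N + 1)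
    (hp : fn π N = 0) (hl : fn π (N + 1) = 1) : ∃ σ, fn σ (N - 1) = 0 ∧ wrapTwo σ = π := by
  obtain ⟨σ, hσ⟩ := exists_extendEnds_eq
    (swap ⟨N + 1, by omega⟩ ⟨1, by omega⟩ * (swap ⟨0, by omega⟩ ⟨N + 1, by omega⟩ * π))
    (by rw [fn_swap_mul, fn_swap_mul, h0]; grind)
    (by rw [fn_swap_mul, fn_swap_mul, hl]; grind)
  refine ⟨σ, ?_, ?_⟩
  · have h1 := fn_extendEnds_interior σ (c := N) (by omega) (by omega)
    rw [hσ, fn_swap_mul, fn_swap_mul, hp] at h1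
    split_ifs at h1 <;> omega
  · rw [wrapTwo, hσ]
    simp only [← mul_assoc, swap_mul_self, one_mul]

/-! ### Counting -/

/-- Good permutations starting with the maximum. -/
def startsMax (n : ℕ) : Set (Perm (Fin n)) := {π | IsGood π ∧ fn π 0 = n - 1}

/-- Good permutations ending with the minimum. -/
def endsMin (n : ℕ) : Set (Perm (Fin n)) := {π | IsGood π ∧ fn π (n - 1) = 0}

theorem persymmetricCount_eq (n : ℕ) :
    persymmetricCount n = {π : Perm (Fin n) | IsGood π}.ncard := rfl

theorem ncard_endsMin (n : ℕ) : (endsMin n).ncard = (startsMax n).ncard := by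
  have h : endsMin n = (fun π => π⁻¹) '' startsMax n := by
    ext π
    simp only [Set.mem_image]
    constructor
    · rintro ⟨h1, h2⟩
      refine ⟨π⁻¹, ⟨h1.inv, ?_⟩, inv_inv π⟩
      rw [← h2, fn_inv_fn]
    · rintro ⟨τ, ⟨h1, h2⟩, rfl⟩
      refine ⟨h1.inv, ?_⟩
      rw [← h2, fn_inv_fn]
  rw [h, Set.ncard_image_of_injective _ inv_injective]

theorem ncard_startsMax_inter_endsMin (N : ℕ) :
    (startsMax (N + 2) ∩ endsMin (N + 2)).ncard = persymmetricCount N := by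
  have h : startsMax (N + 2) ∩ endsMin (N + 2) = wrap '' {σ : Perm (Fin N) | IsGood σ} := by
    ext π
    simp only [Set.mem_image]
    constructor
    · rintro ⟨⟨h1, h2⟩, -, h3⟩
      obtain ⟨σ, rfl⟩ := exists_wrap_eq π h2 h3
      exact ⟨σ, (isGood_wrap σ).1 h1, rfl⟩
    · rintro ⟨σ, hσ, rfl⟩
      have := (isGood_wrap σ).2 hσ
      exact ⟨⟨this, fn_wrap_zero σ⟩, this, fn_wrap_last σ⟩
  rw [h, Set.ncard_image_of_injective _ wrap_injective, persymmetricCount_eq]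

theorem fn_last_of_fn_penultimate {π : Perm (Fin (N + 2))} (h : IsGood π) (hp : fn π N = 0) :
    fn π (N + 1) = 1 := by
  have := (isPersymmetric_iff π).1 h.2.2 N (by omega)
  rw [hp, show N + 2 - 1 - 0 = N + 1 by omega] at this
  omega

theorem ncard_startsMax_penultimate (hN : 1 ≤ N) :
    {π | π ∈ startsMax (N + 2) ∧ fn π N = 0}.ncard = (startsMax N).ncard := by
  have h : {π | π ∈ startsMax (N + 2) ∧ fn π N = 0} = wrapTwo '' endsMin N := by
    ext π
    simp only [Set.mem_image]
    constructor
    · rintro ⟨⟨h1, h2⟩, h3⟩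
      obtain ⟨σ, hσ, rfl⟩ := exists_wrapTwo_eq hN π h2 h3 (fn_last_of_fn_penultimate h1 h3)
      exact ⟨σ, ⟨(isGood_wrapTwo hN hσ).1 h1, hσ⟩, rfl⟩
    · rintro ⟨σ, ⟨h1, hσ⟩, rfl⟩
      exact ⟨⟨(isGood_wrapTwo hN hσ).2 h1, fn_wrapTwo_zero hN⟩, fn_wrapTwo_penultimate hN hσ⟩
  rw [h, Set.ncard_image_of_injective _ wrapTwo_injective, ncard_endsMin]

/-- The length fixes h and e, so the last entry m is a complete invariant, ranging over 2, …, h. -/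
theorem ncard_startsMax_exceptional (hn : 3 ≤ n) :
    {π | π ∈ startsMax n ∧ ∃ K < n - 2, fn π K = 0}.ncard = (n - 1) / 2 - 1 := by
  set F := {π | π ∈ startsMax n ∧ ∃ K < n - 2, fn π K = 0} with hF
  have key : ∀ π ∈ F, 2 ≤ fn π (n - 1) ∧ fn π (n - 1) ≤ (n - 1) / 2 ∧
      ∀ c < n, fn π c = excFn ((n - 1) / 2) ((n - 1) % 2) (fn π (n - 1)) c := by
    rintro π ⟨⟨h1, h2⟩, K, hK, h3⟩
    obtain ⟨h, e, m, hn', he, hm, hmh, hfn⟩ := h1.eq_excFn hn h2 h3 hK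
    have e1 : (n - 1) / 2 = h := by omega
    have e2 : (n - 1) % 2 = e := by omega
    have e3 : fn π (n - 1) = m := by
      rw [hfn _ (by omega), show n - 1 = 2 * h + e by omega, excFn_last hm hmh]
    rw [e1, e2, e3]
    exact ⟨hm, hmh, hfn⟩
  have hinj : Set.InjOn (fun π : Perm (Fin n) => fn π (n - 1)) F := by
    intro π hπ τ hτ h
    refine eq_of_fn_eq fun c hc => ?_
    rw [(key π hπ).2.2 c hc, (key τ hτ).2.2 c hc]
    simp only at h
    rw [h]
  have himg : (fun π : Perm (Fin n) => fn π (n - 1)) '' F = Set.Icc 2 ((n - 1) / 2) := by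
    ext m
    simp only [Set.mem_image, Set.mem_Icc]
    constructor
    · rintro ⟨π, hπ, rfl⟩
      exact ⟨(key π hπ).1, (key π hπ).2.1⟩
    · rintro ⟨hm, hmh⟩
      obtain ⟨h, hh⟩ : ∃ h, h = (n - 1) / 2 := ⟨_, rfl⟩
      obtain ⟨e, he⟩ : ∃ e, e = (n - 1) % 2 := ⟨_, rfl⟩
      rw [← hh] at hmh
      obtain ⟨π, hfn, hgood⟩ := exists_excPerm (n := n) (h := h) (e := e) (m := m)
        (by omega) (by omega) hm hmh
      refine ⟨π, ⟨⟨hgood, ?_⟩, 2 * h + e - m, by omega, ?_⟩, ?_⟩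
      · rw [hfn 0 (by omega), excFn_zero]; omega
      · rw [hfn _ (by omega), excFn_pos_of_min hm hmh]
      · rw [hfn _ (by omega), show n - 1 = 2 * h + e by omega, excFn_last hm hmh]
  rw [← hinj.ncard_image, himg, ← Finset.coe_Icc, Set.ncard_coe_finset, Nat.card_Icc]
  omega

/-- The three summands correspond to the minimum being last, penultimate or earlier. -/
theorem ncard_startsMax (hN : 1 ≤ N) : (startsMax (N + 2)).ncard =
    persymmetricCount N + (startsMax N).ncard + ((N + 1) / 2 - 1) := by
  set B := {π | π ∈ startsMax (N + 2) ∧ fn π N = 0}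
  set F := {π | π ∈ startsMax (N + 2) ∧ ∃ K < N, fn π K = 0}
  have hunion : startsMax (N + 2) = (startsMax (N + 2) ∩ endsMin (N + 2)) ∪ B ∪ F := by
    ext π
    constructor
    · intro hπ
      obtain ⟨K, hK⟩ := fn_surjective π 0
      have hKn : K < N + 2 := by rw [← fn_lt_iff π]; omega
      rcases (show K = N + 1 ∨ K = N ∨ K < N by omega) with h | h | h
      · exact Or.inl (Or.inl ⟨hπ, hπ.1, by rw [← hK, h]; rfl⟩)
      · exact Or.inl (Or.inr ⟨hπ, h ▸ hK⟩)
      · exact Or.inr ⟨hπ, K, h, hK⟩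
    · rintro ((h | h) | h) <;> exact h.1
  have hd1 : Disjoint (startsMax (N + 2) ∩ endsMin (N + 2)) B := by
    rw [Set.disjoint_left]
    rintro π ⟨-, -, h1⟩ ⟨-, h2⟩
    have := fn_injective π (h1.trans h2.symm)
    omega
  have hd2 : Disjoint ((startsMax (N + 2) ∩ endsMin (N + 2)) ∪ B) F := by
    rw [Set.disjoint_left]
    rintro π (⟨-, -, h1⟩ | ⟨-, h1⟩) ⟨-, K, hK, h2⟩
    · have := fn_injective π (h1.trans h2.symm)
      omega
    · have := fn_injective π (h1.trans h2.symm)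
      omega
  conv_lhs => rw [hunion]
  rw [Set.ncard_union_eq hd2 (Set.toFinite _) (Set.toFinite _),
    Set.ncard_union_eq hd1 (Set.toFinite _) (Set.toFinite _), ncard_startsMax_inter_endsMin,
    ncard_startsMax_penultimate hN]
  exact congrArg _ (ncard_startsMax_exceptional (n := N + 2) (by omega))

theorem ncard_good_neither (hn : 3 ≤ n) :
    {π : Perm (Fin n) | IsGood π ∧ fn π 0 ≠ n - 1 ∧ fn π (n - 1) ≠ 0}.ncard =
      if n % 2 = 0 then 1 else 0 := by
  split_ifs with h
  · obtain ⟨M, hM⟩ : ∃ M, n = 2 * M := ⟨n / 2, by omega⟩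
    obtain ⟨τ, hτ, hgood⟩ := exists_twoBlock hM
    rw [Set.ncard_eq_one]
    refine ⟨τ, Set.eq_singleton_iff_unique_mem.2 ⟨⟨hgood, ?_, ?_⟩, ?_⟩⟩
    · rw [hτ 0 (by omega), twoBlockFn, if_pos (by omega)]; omega
    · rw [hτ _ (by omega), twoBlockFn, if_neg (by omega)]; omega
    · rintro π ⟨h1, h2, h3⟩
      obtain ⟨M', hM', hfn⟩ := h1.eq_twoBlockFn hn h2 h3
      have : M' = M := by omega
      subst this
      exact eq_of_fn_eq fun c hc => by rw [hfn c hc, hτ c hc]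
  · rw [Set.ncard_eq_zero]
    refine Set.eq_empty_iff_forall_notMem.2 ?_
    rintro π ⟨h1, h2, h3⟩
    obtain ⟨M', hM', -⟩ := h1.eq_twoBlockFn hn h2 h3
    omega

/-- Inclusion–exclusion for `startsMax` and `endsMin`, which have equal size and meet in
`persymmetricCount N` elements. -/
theorem persymmetricCount_add_two (hN : 1 ≤ N) : persymmetricCount (N + 2) + persymmetricCount N =
    2 * (startsMax (N + 2)).ncard + if N % 2 = 0 then 1 else 0 := by
  set X := {π : Perm (Fin (N + 2)) | IsGood π ∧ fn π 0 ≠ N + 2 - 1 ∧ fn π (N + 2 - 1) ≠ 0} with hX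
  have hunion : {π : Perm (Fin (N + 2)) | IsGood π} =
      (startsMax (N + 2) ∪ endsMin (N + 2)) ∪ X := by
    ext π
    constructor
    · intro hπ
      by_cases h1 : fn π 0 = N + 2 - 1
      · exact Or.inl (Or.inl ⟨hπ, h1⟩)
      · by_cases h2 : fn π (N + 2 - 1) = 0
        · exact Or.inl (Or.inr ⟨hπ, h2⟩)
        · exact Or.inr ⟨hπ, h1, h2⟩
    · rintro ((h | h) | h) <;> exact h.1
  have hd : Disjoint (startsMax (N + 2) ∪ endsMin (N + 2)) X := by
    rw [Set.disjoint_left]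
    rintro π (⟨-, h1⟩ | ⟨-, h1⟩) ⟨-, h2, h3⟩
    · exact h2 h1
    · exact h3 h1
  have h1 := Set.ncard_union_add_ncard_inter (startsMax (N + 2)) (endsMin (N + 2))
    (Set.toFinite _) (Set.toFinite _)
  rw [ncard_startsMax_inter_endsMin, ncard_endsMin] at h1
  have h2 := ncard_good_neither (n := N + 2) (by omega)
  rw [persymmetricCount_eq, hunion, Set.ncard_union_eq hd (Set.toFinite _) (Set.toFinite _), h2,
    Nat.add_mod_right]
  omega

/-! ### Small sizes -/

theorem isGood_one_of_le_two (hn : n ≤ 2) : IsGood (1 : Perm (Fin n)) := by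
  have h : ∀ c, fn (1 : Perm (Fin n)) c = c := fun c => by
    by_cases hc : c < n
    · rw [fn_of_lt _ hc]; rfl
    · exact fn_of_le _ (by omega)
  refine ⟨isShallow_of_forall_fn_eq h, (avoids123_iff _).2 fun a b c _ _ _ => by omega,
    (isPersymmetric_iff _).2 fun c _ => ?_⟩
  rw [h, h]

theorem persymmetricCount_of_le_one (hn : n ≤ 1) : persymmetricCount n = 1 := by
  rw [persymmetricCount_eq, Set.ncard_eq_one]
  refine ⟨1, Set.eq_singleton_iff_unique_mem.2 ⟨isGood_one_of_le_two (by omega), fun π _ => ?_⟩⟩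
  refine eq_of_fn_eq fun c hc => ?_
  have h1 := (fn_lt_iff π (c := c)).2 hc
  have h2 := (fn_lt_iff (1 : Perm (Fin n)) (c := c)).2 hc
  omega

theorem ncard_startsMax_one : (startsMax 1).ncard = 1 := by
  have h : startsMax 1 = {π | IsGood π} := by
    ext π
    refine ⟨fun h => h.1, fun h => ⟨h, ?_⟩⟩
    have := (fn_lt_iff π (c := 0)).2 (by omega)
    omega
  rw [h, ← persymmetricCount_eq, persymmetricCount_of_le_one le_rfl]

theorem startsMax_two_subset : startsMax 2 ⊆ endsMin 2 := by
  rintro π ⟨h1, h2⟩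
  refine ⟨h1, show fn π 1 = 0 from ?_⟩
  have h3 := (fn_lt_iff π (c := 1)).2 (by omega)
  have h4 := (fn_injective π).ne (show 0 ≠ 1 by omega)
  omega

theorem ncard_startsMax_two : (startsMax 2).ncard = 1 := by
  rw [← Set.inter_eq_left.2 startsMax_two_subset, ncard_startsMax_inter_endsMin,
    persymmetricCount_of_le_one (by omega)]

theorem persymmetricCount_two : persymmetricCount 2 = 2 := by
  have h : {π : Perm (Fin 2) | IsGood π} = startsMax 2 ∪ {1} := by
    ext π
    constructor
    · intro hπ
      by_cases h1 : fn π 0 = 1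
      · exact Or.inl ⟨hπ, h1⟩
      · right
        have h2 := (fn_lt_iff π (c := 0)).2 (by omega)
        have h3 := (fn_lt_iff π (c := 1)).2 (by omega)
        have h4 := (fn_injective π).ne (show 0 ≠ 1 by omega)
        refine eq_of_fn_eq fun c hc => ?_
        rcases (show c = 0 ∨ c = 1 by omega) with h | h <;> subst h
        · exact (show fn π 0 = 0 by omega)
        · exact (show fn π 1 = 1 by omega)
    · rintro (h | h)
      · exact h.1
      · rw [h]; exact isGood_one_of_le_two le_rfl
  have hd : Disjoint (startsMax 2) {1} := by
    rw [Set.disjoint_singleton_right]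
    rintro ⟨-, h⟩
    exact absurd (show (0 : ℕ) = 1 from h) (by omega)
  rw [persymmetricCount_eq, h, Set.ncard_union_eq hd (Set.toFinite _) (Set.toFinite _),
    ncard_startsMax_two, Set.ncard_singleton]

/-! ### The recurrence and the generating function -/

theorem persymmetricCount_three : persymmetricCount 3 = 3 := by
  have h1 := persymmetricCount_add_two (N := 1) le_rfl
  have h2 := ncard_startsMax (N := 1) le_rfl
  rw [persymmetricCount_of_le_one le_rfl] at h1 h2
  rw [ncard_startsMax_one] at h2
  simp only [Nat.reduceAdd, Nat.reduceMod, Nat.reduceDiv] at h1 h2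
  rw [if_neg (by omega)] at h1
  omega

theorem two_mul_ncard_startsMax (n : ℕ) : 2 * (startsMax (n + 2)).ncard +
    (if n % 2 = 0 then 1 else 0) = persymmetricCount (n + 2) + persymmetricCount n := by
  rcases Nat.eq_zero_or_pos n with rfl | hn
  · rw [ncard_startsMax_two, persymmetricCount_two, persymmetricCount_of_le_one (by omega)]; rfl
  · exact (persymmetricCount_add_two hn).symm

/-- Eliminates `startsMax`; the parity terms at n and n + 2 agree and cancel. -/
theorem persymmetricCount_add_four (n : ℕ) : persymmetricCount (n + 4) =
    2 * persymmetricCount (n + 2) + persymmetricCount n + 2 * ((n + 3) / 2 - 1) := by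
  have h1 := two_mul_ncard_startsMax (n + 2)
  have h2 := two_mul_ncard_startsMax n
  have h3 := ncard_startsMax (N := n + 2) (by omega)
  rw [Nat.add_mod_right] at h1
  simp only [add_assoc, Nat.reduceAdd] at h1 h3
  split_ifs at h1 h2 <;> omega

/-- Applying the operator with polynomial (x - 1)²(x + 1) removes the floor term; the coefficients
are those of the expanded denominator. -/
theorem persymmetricCount_linear_recurrence (n : ℕ) :
    persymmetricCount (n + 7) + 3 * persymmetricCount (n + 4) + persymmetricCount (n + 3) +
      persymmetricCount (n + 1) = persymmetricCount (n + 6) + 3 * persymmetricCount (n + 5) +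
      persymmetricCount (n + 2) + persymmetricCount n := by
  have h0 := persymmetricCount_add_four n
  have h1 := persymmetricCount_add_four (n + 1)
  have h2 := persymmetricCount_add_four (n + 2)
  have h3 := persymmetricCount_add_four (n + 3)
  simp only [add_assoc, Nat.reduceAdd] at h1 h2 h3
  omega

end ShallowPerm

open PowerSeries in
theorem ShallowPerm.mul_mk_persymmetricCount :
    ((X - 1) ^ 2 * (X + 1) * (1 - 2 * X ^ 2 - X ^ 4) : PowerSeries ℚ) *
      (PowerSeries.mk fun n : ℕ => (ShallowPerm.persymmetricCount n : ℚ)) =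
    (X ^ 6 + X ^ 5 + X ^ 3 - 2 * X ^ 2 + 1 : PowerSeries ℚ) := by
  set P : PowerSeries ℚ := PowerSeries.mk fun n : ℕ => (persymmetricCount n : ℚ) with hP
  have h1 : ((X - 1) ^ 2 * (X + 1) * (1 - 2 * X ^ 2 - X ^ 4) : PowerSeries ℚ) * P =
      P - X ^ 1 * P - (X ^ 2 * P + X ^ 2 * P + X ^ 2 * P) + (X ^ 3 * P + X ^ 3 * P + X ^ 3 * P) +
        X ^ 4 * P - X ^ 5 * P + X ^ 6 * P - X ^ 7 * P := by ring
  have h2 : (X ^ 6 + X ^ 5 + X ^ 3 - 2 * X ^ 2 + 1 : PowerSeries ℚ) =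
      X ^ 6 + X ^ 5 + X ^ 3 - (X ^ 2 + X ^ 2) + 1 := by ring
  rw [h1, h2]
  ext n
  simp only [map_add, map_sub, coeff_X_pow_mul', coeff_X_pow, coeff_one, hP, coeff_mk]
  -- The denominator has degree 7 and the numerator degree 6: coefficients below 7 are computed from
  -- the initial values, and from 7 on the recurrence gives zero.
  rcases Nat.lt_or_ge n 7 with hn | hn
  · have p0 := persymmetricCount_of_le_one (n := 0) (by omega)
    have p1 := persymmetricCount_of_le_one (n := 1) le_rfl
    have p2 := persymmetricCount_two
    have p3 := persymmetricCount_three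
    have p4 := persymmetricCount_add_four 0
    have p5 := persymmetricCount_add_four 1
    have p6 := persymmetricCount_add_four 2
    simp only [Nat.reduceAdd, Nat.reduceDiv, Nat.reduceSub, Nat.reduceMul, p0, p1, p2, p3] at p4 p5
    simp only [Nat.reduceAdd, Nat.reduceDiv, Nat.reduceSub, Nat.reduceMul, p2, p4] at p6
    interval_cases n <;> simp [p0, p1, p2, p3, p4, p5, p6] <;> norm_num
  · obtain ⟨k, rfl⟩ : ∃ k, n = k + 7 := ⟨n - 7, by omega⟩
    have h := persymmetricCount_linear_recurrence k
    have h' : (persymmetricCount (k + 7) + 3 * persymmetricCount (k + 4) +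
        persymmetricCount (k + 3) + persymmetricCount (k + 1) : ℚ) = persymmetricCount (k + 6) +
        3 * persymmetricCount (k + 5) + persymmetricCount (k + 2) + persymmetricCount k := by
      exact_mod_cast h
    rw [if_pos (by omega), if_pos (by omega), if_pos (by omega), if_pos (by omega),
      if_pos (by omega), if_pos (by omega), if_pos (by omega), if_neg (by omega),
      if_neg (by omega), if_neg (by omega), if_neg (by omega), if_neg (by omega),
      show k + 7 - 1 = k + 6 by omega, show k + 7 - 2 = k + 5 by omega,
      show k + 7 - 3 = k + 4 by omega, show k + 7 - 4 = k + 3 by omega,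
      show k + 7 - 5 = k + 2 by omega, show k + 7 - 6 = k + 1 by omega, Nat.add_sub_cancel]
    linarith

theorem mainTheorem11 :
    (PowerSeries.mk fun n : ℕ => (ShallowPerm.persymmetricCount n : ℚ)) =
      (PowerSeries.X ^ 6 + PowerSeries.X ^ 5 + PowerSeries.X ^ 3
          - 2 * PowerSeries.X ^ 2 + 1 : PowerSeries ℚ) *
        ((PowerSeries.X - 1) ^ 2 * (PowerSeries.X + 1) *
          (1 - 2 * PowerSeries.X ^ 2 - PowerSeries.X ^ 4) : PowerSeries ℚ)⁻¹ := by
  rw [PowerSeries.eq_mul_inv_iff_mul_eq (by simp), mul_comm]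
  exact ShallowPerm.mul_mk_persymmetricCount
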